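/- Let $m\ge 3$, and let $\mathcal P^m$ be the space of convex polygons in $\mathbb R^2$ with exactly $m$ vertices that contain the origin in their interior, with its natural smooth structure (locally, the coordinates are the positions of the $m$ vertices). For $P\in\mathcal P^m$ let $v_1,\dots,v_m$ be its consecutive vertices (cyclic index) and let $e_1,\dots,e_m$ be the vertices of the polar polygon $P^\circ=\{y:\langle y,x\rangle\le 1\ \forall x\in P\}$, which correspond to the edges of $P$. Define $$c_1(P)=\frac12\sum_{i\sim j}\log\bigl(1-\langle e_i,v_j\rangle\bigr),$$ where $i\sim j$ means that $\langle e_i,v_j\rangle\ne 1$ and $\langle e_i,v_{j+k}\rangle=1$ for some $k\in\{-1,1\}$ (for $m=3$ each such pair is counted twice, once for each value of $k$, so that the sum always has $2m$ terms). For $x\in\operatorname{int}P$ put $c_1(P,x)=c_1(P-x)$, and let $s_\infty(P)\in\operatorname{int}P$ be the unique point at which $x\mapsto c_1(P,x)$ attains its minimum over $\operatorname{int}P$. Let $R^m$ be the regular $m$-gon centered at the origin. 1. If the functional $c_1\colon\mathcal P^m\to\mathbb R$ is stationary at $P\in\mathcal P^m$ (that is, its derivative at $P$ vanishes), then $P=g(R^m)$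 for some $g\in GL_2(\mathbb R)$. 2. Among all $P\in\mathcal P^m$ with $s_\infty(P)=0$, the functional $c_1$ attains its maximum, and it does so exactly at the linear images $g(R^m)$, $g\in GL_2(\mathbb R)$. -/

import Mathlib

/-- The Euclidean plane. -/
abbrev Plane : Type := EuclideanSpace ℝ (Fin 2)

/-- `v 0, …, v (m - 1)` are the consecutive vertices (with cyclic index; `finRotate m` is the
cyclic successor) of a convex polygon that contains the origin in its interior: any two consecutive
points span an edge of the convex hull, i.e. they lie on a line `⟪e, ·⟫ = 1` and all the other
points lie strictly on the origin's side of that line. -/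
def IsVertexCycle {m : ℕ} (v : Fin m → Plane) : Prop :=
  Function.Injective v ∧
  (0 : Plane) ∈ interior (convexHull ℝ (Set.range v)) ∧
  ∀ i : Fin m, ∃ e : Plane,
    inner ℝ e (v i) = 1 ∧ inner ℝ e (v (finRotate m i)) = 1 ∧
    ∀ j : Fin m, j ≠ i → j ≠ finRotate m i → inner ℝ e (v j) < 1

/-- The space of convex polygons with `m` vertices that contain the origin in their interior
(meaningful for `3 ≤ m`). -/
def polygons (m : ℕ) : Set (Set Plane) :=
  {P | ∃ v : Fin m → Plane, IsVertexCycle v ∧ P = convexHull ℝ (Set.range v)}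

/-- The polar (dual) body `P° = {y | ⟪y, x⟫ ≤ 1 for all x ∈ P}`. -/
def polarBody (P : Set Plane) : Set Plane :=
  {y | ∀ x ∈ P, inner ℝ y x ≤ 1}

/-- The vertices `v_j` of a polygon. -/
def vertices (P : Set Plane) : Set Plane := P.extremePoints ℝ

/-- The edges `e_i` of a polygon, identified with the vertices of the polar polygon;
the edge `e` contains the vertex `v` when `⟪e, v⟫ = 1`. -/
def dualVertices (P : Set Plane) : Set Plane := (polarBody P).extremePoints ℝ

/-- `v` and `v'` are neighbouring vertices of `P`: they are the two endpoints of an edge. -/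
def IsNeighbor (P : Set Plane) (v v' : Plane) : Prop :=
  v ∈ vertices P ∧ v' ∈ vertices P ∧ v ≠ v' ∧
    ∃ e ∈ dualVertices P, inner ℝ e v = 1 ∧ inner ℝ e v' = 1

/-- The index set of the sum over `i ∼ j`: the triples `(e_i, v_j, v_{j+k})` with `k = ± 1`
such that `⟪e_i, v_j⟫ ≠ 1` and `⟪e_i, v_{j+k}⟫ = 1`. They correspond to the flags of the polygon
(the flag being `v_j` together with the edge from `v_j` to `v_{j+k}`), so an `m`-gon has `2 m` of
them; in a triangle each pair `(e_i, v_j)` with `i ∼ j` occurs for both values of `k`. -/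
def adjacentTriples (P : Set Plane) : Set (Plane × Plane × Plane) :=
  {t | t.1 ∈ dualVertices P ∧ IsNeighbor P t.2.1 t.2.2 ∧
    inner ℝ t.1 t.2.1 ≠ (1 : ℝ) ∧ inner ℝ t.1 t.2.2 = (1 : ℝ)}

/-- `c₁(P) = ½ ∑_{i ∼ j} log (1 - ⟪e_i, v_j⟫)`. -/
noncomputable def secondTerm (P : Set Plane) : ℝ :=
  (1 / 2) * ∑ᶠ t ∈ adjacentTriples P, Real.log (1 - inner ℝ t.1 t.2.1)

/-- `c₁(P, x)`: the functional with respect to the centre `x`, that is, `c₁(P - x)`. -/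
noncomputable def secondTermAt (P : Set Plane) (x : Plane) : ℝ :=
  secondTerm ((fun p => p - x) '' P)

/-- `s = s_∞(P)`: the point `s` is the unique minimum of `x ↦ c₁(P, x)` on the interior of `P`. -/
def IsSantaloPointAtInfinity (P : Set Plane) (s : Plane) : Prop :=
  s ∈ interior P ∧ ∀ x ∈ interior P, x ≠ s → secondTermAt P s < secondTermAt P x

/-- `c₁` is stationary at the `m`-gon `P`: the space of `m`-gons is coordinatized near `P` by the
positions of the `m` vertices, and in these coordinates `c₁` is differentiable at `P` with
vanishing derivative. -/
def IsStationaryAt (m : ℕ) (P : Set Plane) : Prop :=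
  ∃ v : Fin m → Plane, IsVertexCycle v ∧ P = convexHull ℝ (Set.range v) ∧
    HasFDerivAt (fun w : Fin m → Plane => secondTerm (convexHull ℝ (Set.range w)))
      (0 : (Fin m → Plane) →L[ℝ] ℝ) v

/-- The regular `m`-gon centred at the origin (with circumradius one). -/
noncomputable def regularPolygon (m : ℕ) : Set Plane :=
  convexHull ℝ (Set.range fun k : Fin m =>
    (!₂[Real.cos (2 * Real.pi * (k : ℝ) / m), Real.sin (2 * Real.pi * (k : ℝ) / m)] : Plane))

/-- `P` is the image of the regular `m`-gon under an element of `GL₂(ℝ)`. -/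
def IsLinearImageOfRegular (m : ℕ) (P : Set Plane) : Prop :=
  ∃ g : Plane ≃ₗ[ℝ] Plane, P = g '' regularPolygon m

/-! With vertices v_i put D_i = det(v_i, v_{i+1}), f_i = (v_{i+1} - v_i)/D_i (the polar vertices
turned by a right angle, so that pairings become determinants) and E_i = det(f_{i-1}, f_i). Then
v_{i+1} = v_i + D_i f_i and f_i = f_{i-1} - E_i v_i, and the logarithms in c₁ have arguments D_{i-1}
E_i and D_{i+1} E_{i+1}. Hence c₁ = Σ log |D_i| + Σ log |E_i|, which is invariant under polarity and
under GL₂.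

Critical points: a vanishing gradient makes D_i E_i and D_i E_{i+1} independent of i. Going once
around the cycle, these two constants must agree, so D and E are constant. Then v_{i+1} + v_{i-1} =
(2 - DE) v_i, whose solutions run along an ellipse with a fixed angular step, and convexity forces
the step 2π/m (`areas_const_of_areaGradient_eq_zero`, `eq_regCycle_of_const`).

Maximum: translating by x changes c₁ by -Σ log(1 - det(x, f_i)), so the minimum over x is at 0
exactly when Σ f_i = 0. By polarity it is enough to maximize over cycles with Σ v_i = 0. At a
constrained maximum all vertex gradients equal a multiplier ξ, and two summations by parts give Σ
det(v_i, ξ)² = Σ det(v_i, ξ) = 0, so ξ = 0 and the point is critical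
(`areaGradient_eq_zero_of_const`). A maximum exists because, after normalizing by GL₂, a lower bound
on c₁ confines the cycles to a compact set (`mem_normalizedCycles`). -/

namespace CyclicPolygon

/-! ### Determinants in the plane. -/

/-- The determinant of two vectors of the plane. -/
def cross (a b : Plane) : ℝ := a 0 * b 1 - a 1 * b 0

/-- Twice the signed area of the triangle with vertices `a`, `b`, `c`. -/
def triArea (a b c : Plane) : ℝ := cross a b + cross b c + cross c a

lemma plane_ext {a b : Plane} (h0 : a 0 = b 0) (h1 : a 1 = b 1) : a = b := by
  ext i
  fin_cases i
  · exact h0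
  · exact h1

lemma inner_eq_coord (x y : Plane) : inner ℝ x y = x 0 * y 0 + x 1 * y 1 := by
  simp [PiLp.inner_apply, Fin.sum_univ_two]
  ring

@[simp] lemma cross_same (a : Plane) : cross a a = 0 := by simp [cross]; ring

lemma cross_comm (a b : Plane) : cross a b = -cross b a := by simp [cross]; ring

@[simp] lemma cross_zero_left (a : Plane) : cross 0 a = 0 := by simp [cross]

@[simp] lemma cross_zero_right (a : Plane) : cross a 0 = 0 := by simp [cross]

lemma cross_add_left (a b c : Plane) : cross (a + b) c = cross a c + cross b c := by
  simp [cross]; ring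

lemma cross_add_right (a b c : Plane) : cross a (b + c) = cross a b + cross a c := by
  simp [cross]; ring

lemma cross_sub_left (a b c : Plane) : cross (a - b) c = cross a c - cross b c := by
  simp [cross]; ring

lemma cross_sub_right (a b c : Plane) : cross a (b - c) = cross a b - cross a c := by
  simp [cross]; ring

lemma cross_neg_left (a b : Plane) : cross (-a) b = -cross a b := by
  simp [cross]; ring

lemma cross_neg_right (a b : Plane) : cross a (-b) = -cross a b := by
  simp [cross]; ring

lemma cross_smul_left (r : ℝ) (a b : Plane) : cross (r • a) b = r * cross a b := by
  simp [cross]; ring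

lemma cross_smul_right (r : ℝ) (a b : Plane) : cross a (r • b) = r * cross a b := by
  simp [cross]; ring

lemma cross_sum_left {ι : Type*} (s : Finset ι) (f : ι → Plane) (b : Plane) :
    cross (∑ i ∈ s, f i) b = ∑ i ∈ s, cross (f i) b := by
  classical
  induction s using Finset.induction_on with
  | empty => simp
  | insert i s hi ih => rw [Finset.sum_insert hi, Finset.sum_insert hi, cross_add_left, ih]

lemma cross_sum_right {ι : Type*} (s : Finset ι) (f : ι → Plane) (b : Plane) :
    cross b (∑ i ∈ s, f i) = ∑ i ∈ s, cross b (f i) := by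
  rw [cross_comm, cross_sum_left, ← Finset.sum_neg_distrib]
  exact Finset.sum_congr rfl fun i _ => (cross_comm _ _).symm

/-- Cramer's rule. -/
lemma cross_smul_eq (a b x : Plane) : cross a b • x = cross x b • a + cross a x • b := by
  apply plane_ext <;> simp [cross] <;> ring

lemma eq_of_cross_eq {a b x y : Plane} (h : cross a b ≠ 0) (ha : cross x a = cross y a)
    (hb : cross x b = cross y b) : x = y := by
  have hx := cross_smul_eq a b x
  have hy := cross_smul_eq a b y
  rw [cross_comm a x, ha, hb, ← cross_comm a y, ← hy] at hx
  exact smul_right_injective _ h hx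

/-- The rotation by a right angle that turns `cross` into the inner product. -/
def quarterTurn : Plane ≃ₗ[ℝ] Plane where
  toFun f := !₂[f 1, -f 0]
  invFun f := !₂[-f 1, f 0]
  map_add' a b := by apply plane_ext <;> simp; ring
  map_smul' r a := by apply plane_ext <;> simp
  left_inv a := by apply plane_ext <;> simp
  right_inv a := by apply plane_ext <;> simp

lemma inner_quarterTurn (f x : Plane) : inner ℝ (quarterTurn f) x = cross x f := by
  rw [inner_eq_coord]; simp [quarterTurn, cross]; ring

/-! ### Convex cycles and their polar cycles. -/

section Cycle

variable {m : ℕ} [NeZero m]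

/-- Twice the signed area of the triangle formed by the origin and the `i`-th edge. -/
def edgeArea (v : Fin m → Plane) (i : Fin m) : ℝ := cross (v i) (v (i + 1))

/-- Twice the signed area of the triangle formed by the `i`-th vertex and its neighbours. -/
def cornerArea (v : Fin m → Plane) (i : Fin m) : ℝ := triArea (v (i - 1)) (v i) (v (i + 1))

/-- The `i`-th vertex of the polar polygon, turned by a right angle. -/
noncomputable def polarCycle (v : Fin m → Plane) (i : Fin m) : Plane :=
  (edgeArea v i)⁻¹ • (v (i + 1) - v i)

/-- Twice the signed area of the triangle formed by the origin and the edge of the polar polygon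
that corresponds to the `i`-th vertex. -/
noncomputable def polarArea (v : Fin m → Plane) (i : Fin m) : ℝ :=
  cross (polarCycle v (i - 1)) (polarCycle v i)

/-- `v` runs, in one of the two orientations, through the vertices of a convex polygon that
contains the origin in its interior; the condition is expressed by determinants. -/
structure IsConvexCycle (v : Fin m → Plane) : Prop where
  edgeArea_ne : ∀ i, edgeArea v i ≠ 0
  cross_lt : ∀ i j, j ≠ i → j ≠ i + 1 → cross (v j) (polarCycle v i) < 1

variable {v : Fin m → Plane}

lemma succ_eq_add_smul (h : ∀ i, edgeArea v i ≠ 0) (i : Fin m) :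
    v (i + 1) = v i + edgeArea v i • polarCycle v i := by
  rw [polarCycle, smul_smul, mul_inv_cancel₀ (h i), one_smul]; abel

lemma cross_polarCycle_self (h : ∀ i, edgeArea v i ≠ 0) (i : Fin m) :
    cross (v i) (polarCycle v i) = 1 := by
  rw [polarCycle, cross_smul_right, cross_sub_right, cross_same, sub_zero]
  exact inv_mul_cancel₀ (h i)

lemma cross_succ_polarCycle (h : ∀ i, edgeArea v i ≠ 0) (i : Fin m) :
    cross (v (i + 1)) (polarCycle v i) = 1 := by
  rw [succ_eq_add_smul h, cross_add_left, cross_smul_left, cross_same,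
    cross_polarCycle_self h, mul_zero, add_zero]

lemma cross_polarCycle_pred (h : ∀ i, edgeArea v i ≠ 0) (i : Fin m) :
    cross (v i) (polarCycle v (i - 1)) = 1 := by
  simpa using cross_succ_polarCycle h (i - 1)

/-- Cramer's rule: `v i` pairs to 1 with both `polarCycle v (i - 1)` and `polarCycle v i`. This is
the dual of `succ_eq_add_smul`. -/
lemma polarCycle_eq_sub (h : ∀ i, edgeArea v i ≠ 0) (i : Fin m) :
    polarCycle v i = polarCycle v (i - 1) - polarArea v i • v i := by
  have h1 := cross_polarCycle_self h i
  have h2 := cross_polarCycle_pred h i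
  set a := polarCycle v (i - 1) with ha
  set b := polarCycle v i with hb
  have key := cross_smul_eq a b (v i)
  rw [polarArea, ← ha, ← hb, key, h1, cross_comm a, h2]
  simp

lemma pred_eq_sub_smul (h : ∀ i, edgeArea v i ≠ 0) (i : Fin m) :
    v (i - 1) = v i - edgeArea v (i - 1) • polarCycle v (i - 1) := by
  have := succ_eq_add_smul h (i - 1)
  rw [sub_add_cancel] at this
  rw [this]; abel

lemma polarCycle_succ (h : ∀ i, edgeArea v i ≠ 0) (i : Fin m) :
    polarCycle v (i + 1) = polarCycle v i - polarArea v (i + 1) • v (i + 1) := by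
  simpa using polarCycle_eq_sub h (i + 1)

lemma polarArea_succ (v : Fin m → Plane) (i : Fin m) :
    polarArea v (i + 1) = cross (polarCycle v i) (polarCycle v (i + 1)) := by
  simp [polarArea]

lemma cornerArea_eq (h : ∀ i, edgeArea v i ≠ 0) (i : Fin m) :
    cornerArea v i = edgeArea v (i - 1) * edgeArea v i * polarArea v i := by
  rw [cornerArea, triArea, pred_eq_sub_smul h i, succ_eq_add_smul h i, polarArea]
  simp only [cross_sub_left, cross_sub_right, cross_add_left, cross_add_right, cross_smul_left,
    cross_smul_right, cross_same, cross_polarCycle_self h, cross_polarCycle_pred h]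
  rw [cross_comm (polarCycle v (i-1)) (v i), cross_comm (polarCycle v i) (v i),
    cross_comm (polarCycle v i) (polarCycle v (i - 1)),
    cross_polarCycle_self h, cross_polarCycle_pred h]
  ring

/-- This and the next lemma factor the arguments of all logarithms in c₁. -/
lemma one_sub_cross_pred (h : ∀ i, edgeArea v i ≠ 0) (i : Fin m) :
    1 - cross (v (i - 1)) (polarCycle v i) = edgeArea v (i - 1) * polarArea v i := by
  rw [pred_eq_sub_smul h, cross_sub_left, cross_smul_left, cross_polarCycle_self h, polarArea]
  ring

lemma one_sub_cross_succ_succ (h : ∀ i, edgeArea v i ≠ 0) (i : Fin m) :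
    1 - cross (v (i + 1 + 1)) (polarCycle v i) = edgeArea v (i + 1) * polarArea v (i + 1) := by
  rw [succ_eq_add_smul h, cross_add_left, cross_smul_left, cross_succ_polarCycle h, polarArea_succ,
    cross_comm (polarCycle v (i + 1))]
  ring

lemma one_ne_zero_of_three_le (hm : 3 ≤ m) : (1 : Fin m) ≠ 0 := by
  obtain ⟨n, rfl⟩ := Nat.exists_eq_add_of_le' hm
  simp

lemma two_ne_zero_of_three_le (hm : 3 ≤ m) : (1 + 1 : Fin m) ≠ 0 := by
  obtain ⟨n, rfl⟩ := Nat.exists_eq_add_of_le' hm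
  intro h
  have := congrArg Fin.val h
  simp [Fin.val_add, Nat.mod_eq_of_lt] at this

lemma succ_ne (hm : 3 ≤ m) (i : Fin m) : i + 1 ≠ i := fun h =>
  one_ne_zero_of_three_le hm (add_eq_left.mp h)

lemma pred_ne (hm : 3 ≤ m) (i : Fin m) : i - 1 ≠ i := fun h =>
  one_ne_zero_of_three_le hm (sub_eq_self.mp h)

lemma succ_succ_ne (hm : 3 ≤ m) (i : Fin m) : i + 1 + 1 ≠ i := fun h =>
  two_ne_zero_of_three_le hm (add_eq_left.mp ((add_assoc i 1 1).symm.trans h))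

lemma pred_ne_succ (hm : 3 ≤ m) (i : Fin m) : i - 1 ≠ i + 1 := fun h =>
  succ_succ_ne hm i (by rw [← h, sub_add_cancel])

namespace IsConvexCycle

/-- The orientation is free, so edge and polar areas have no prescribed sign; positivity is
available for products of adjacent ones. -/
lemma edgeArea_pred_mul_pos (hm : 3 ≤ m) (h : IsConvexCycle v) (i : Fin m) :
    0 < edgeArea v (i - 1) * polarArea v i := by
  rw [← one_sub_cross_pred h.edgeArea_ne, sub_pos]
  exact h.cross_lt _ _ (pred_ne hm i) (pred_ne_succ hm i)

lemma edgeArea_mul_polarArea_pos (hm : 3 ≤ m) (h : IsConvexCycle v) (i : Fin m) :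
    0 < edgeArea v i * polarArea v i := by
  have := one_sub_cross_succ_succ h.edgeArea_ne (i - 1)
  rw [sub_add_cancel] at this
  rw [← this, sub_pos]
  have h2 := h.cross_lt (i - 1) (i + 1) (pred_ne_succ hm i).symm
  rw [sub_add_cancel] at h2
  exact h2 (succ_ne hm i)

lemma edgeArea_mul_polarArea_succ_pos (hm : 3 ≤ m) (h : IsConvexCycle v) (i : Fin m) :
    0 < edgeArea v i * polarArea v (i + 1) := by
  simpa using h.edgeArea_pred_mul_pos hm (i + 1)

lemma polarArea_ne (hm : 3 ≤ m) (h : IsConvexCycle v) (i : Fin m) : polarArea v i ≠ 0 :=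
  right_ne_zero_of_mul (h.edgeArea_mul_polarArea_pos hm i).ne'

lemma cross_le (h : IsConvexCycle v) (i j : Fin m) : cross (v j) (polarCycle v i) ≤ 1 := by
  by_cases h1 : j = i
  · rw [h1, cross_polarCycle_self h.edgeArea_ne]
  by_cases h2 : j = i + 1
  · rw [h2, cross_succ_polarCycle h.edgeArea_ne]
  exact (h.cross_lt i j h1 h2).le

lemma cross_eq_one_iff (h : IsConvexCycle v) (i j : Fin m) :
    cross (v j) (polarCycle v i) = 1 ↔ j = i ∨ j = i + 1 := by
  constructor
  · intro h1
    by_contra! h2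
    exact (h.cross_lt i j h2.1 h2.2).ne h1
  · rintro (rfl | rfl)
    · exact cross_polarCycle_self h.edgeArea_ne _
    · exact cross_succ_polarCycle h.edgeArea_ne _

/-- A vertex is recovered from its two edges: j ∈ {i, i+1} ∩ {i-1, i} leaves only j = i when m ≥ 3.
-/
lemma injective (hm : 3 ≤ m) (h : IsConvexCycle v) : Function.Injective v := by
  intro i j hij
  have h1 := cross_polarCycle_self h.edgeArea_ne i
  have h2 := cross_polarCycle_pred h.edgeArea_ne i
  rw [hij, h.cross_eq_one_iff] at h1 h2
  rw [sub_add_cancel] at h2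
  rcases h1 with h1 | h1
  · exact h1.symm
  · rcases h2 with h2 | h2
    · exact absurd (h2.symm.trans h1) (pred_ne_succ hm i)
    · exact h2.symm

lemma edgeArea_polarCycle (v : Fin m → Plane) (i : Fin m) :
    edgeArea (polarCycle v) i = polarArea v (i + 1) := (polarArea_succ v i).symm

/-- The sign comes from two quarter turns making a half turn, the shift from the polar edge between
indices i and i+1 being dual to vertex i+1. -/
lemma polarCycle_polarCycle (hm : 3 ≤ m) (h : IsConvexCycle v) (i : Fin m) :
    polarCycle (polarCycle v) i = -v (i + 1) := by
  rw [polarCycle, edgeArea_polarCycle, polarCycle_succ h.edgeArea_ne, sub_sub_cancel_left,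
    smul_neg, smul_smul, inv_mul_cancel₀ (h.polarArea_ne hm _), one_smul]

/-- The polar of a convex cycle is a convex cycle. -/
lemma polar (hm : 3 ≤ m) (h : IsConvexCycle v) : IsConvexCycle (polarCycle v) where
  edgeArea_ne i := by
    rw [edgeArea_polarCycle]; exact h.polarArea_ne hm _
  cross_lt i j h1 h2 := by
    rw [h.polarCycle_polarCycle hm, cross_neg_right, ← cross_comm]
    exact h.cross_lt _ _ h2.symm (by simpa using h1.symm)

lemma polarArea_polarCycle (hm : 3 ≤ m) (h : IsConvexCycle v) (i : Fin m) :
    polarArea (polarCycle v) i = edgeArea v i := by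
  rw [polarArea, h.polarCycle_polarCycle hm, h.polarCycle_polarCycle hm, cross_neg_left,
    cross_neg_right, neg_neg, sub_add_cancel]
  rfl

/-- Every vector lies in the cone over some edge. -/
lemma exists_cone (hm : 3 ≤ m) (h : IsConvexCycle v) (x : Plane) (i : Fin m)
    (h1 : cross x (polarCycle v (i + 1)) ≤ cross x (polarCycle v i))
    (h2 : cross x (polarCycle v (i - 1)) ≤ cross x (polarCycle v i)) :
    ∃ a b : ℝ, 0 ≤ a ∧ 0 ≤ b ∧ a + b = cross x (polarCycle v i) ∧
      x = a • v i + b • v (i + 1) := by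
  have hD := h.edgeArea_ne i
  refine ⟨cross x (v (i + 1)) / edgeArea v i, cross (v i) x / edgeArea v i, ?_, ?_, ?_, ?_⟩
  -- The coefficients are those of Cramer's rule; each comparison with a neighbouring edge fixes the
  -- sign of one of them.
  · rw [polarCycle_succ h.edgeArea_ne, cross_sub_right, cross_smul_right] at h1
    have hp := h.edgeArea_mul_polarArea_succ_pos hm i
    have : cross x (v (i + 1)) / edgeArea v i =
      polarArea v (i + 1) * cross x (v (i + 1)) / (edgeArea v i * polarArea v (i + 1)) := by
      field_simp [h.polarArea_ne hm (i + 1)]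
    rw [this]
    exact div_nonneg (by linarith) hp.le
  · rw [polarCycle_eq_sub h.edgeArea_ne i, cross_sub_right, cross_smul_right] at h2
    have hp := h.edgeArea_mul_polarArea_pos hm i
    have : cross (v i) x / edgeArea v i =
      -(polarArea v i * cross x (v i)) / (edgeArea v i * polarArea v i) := by
      rw [cross_comm (v i) x]
      field_simp [h.polarArea_ne hm i]
    rw [this]
    exact div_nonneg (by linarith) hp.le
  · rw [polarCycle, cross_smul_right, cross_sub_right, cross_comm (v i) x]
    field_simp
    ring
  · apply smul_right_injective _ hD
    simp only [smul_add, smul_smul, mul_div_cancel₀ _ hD]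
    exact cross_smul_eq _ _ _

end IsConvexCycle

end Cycle

lemma convex_setOf_cross_le {ι : Type*} (f : ι → Plane) :
    Convex ℝ {x : Plane | ∀ k, cross x (f k) ≤ 1} := by
  intro x hx y hy a b ha hb hab k
  rw [cross_add_left, cross_smul_left, cross_smul_left]
  nlinarith [mul_le_mul_of_nonneg_left (hx k) ha, mul_le_mul_of_nonneg_left (hy k) hb]

/-! ### Hulls of convex cycles: faces, polar body, flags. -/

section Hull

variable {m : ℕ} [NeZero m] {v : Fin m → Plane}

/-- Two independent functionals attaining their maximum over `S` at `x` pin down both endpoints of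
any segment through `x`. -/
lemma mem_extremePoints_of_cross_le {S : Set Plane} {x f g : Plane} (hfg : cross f g ≠ 0)
    (hf : ∀ y ∈ S, cross y f ≤ 1) (hg : ∀ y ∈ S, cross y g ≤ 1) (hx : x ∈ S)
    (hxf : cross x f = 1) (hxg : cross x g = 1) : x ∈ S.extremePoints ℝ := by
  rw [mem_extremePoints]
  refine ⟨hx, fun y hy z hz ⟨a, b, ha, hb, hab, e⟩ => ?_⟩
  have key : ∀ p : Plane, cross x p = 1 → (∀ y ∈ S, cross y p ≤ 1) →
      cross y p = 1 ∧ cross z p = 1 := by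
    intro p hxp hp
    have h1 : a * cross y p + b * cross z p = 1 := by
      rw [← cross_smul_left, ← cross_smul_left, ← cross_add_left, e, hxp]
    have h2 := hp y hy
    have h3 := hp z hz
    constructor
    · by_contra hne
      nlinarith [mul_lt_mul_of_pos_left (lt_of_le_of_ne h2 hne) ha]
    · by_contra hne
      nlinarith [mul_lt_mul_of_pos_left (lt_of_le_of_ne h3 hne) hb]
  obtain ⟨yf, zf⟩ := key f hxf hf
  obtain ⟨yg, zg⟩ := key g hxg hg
  exact ⟨eq_of_cross_eq hfg (yf.trans hxf.symm) (yg.trans hxg.symm),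
    eq_of_cross_eq hfg (zf.trans hxf.symm) (zg.trans hxg.symm)⟩

namespace IsConvexCycle

/-- The edge with the largest pairing is the one whose cone contains `x`; that largest value `s`
acts as the gauge of `x`. -/
lemma exists_mem_hull_smul (hm : 3 ≤ m) (h : IsConvexCycle v) (x : Plane) :
    ∃ s : ℝ, ∃ p ∈ convexHull ℝ (Set.range v), ∃ i, 0 ≤ s ∧ x = s • p ∧
      s = cross x (polarCycle v i) := by
  obtain ⟨i, hi⟩ := Finite.exists_max fun i => cross x (polarCycle v i)
  obtain ⟨a, b, ha, hb, hab, hx⟩ := h.exists_cone hm x i (hi _) (hi _)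
  have hvi : v i ∈ convexHull ℝ (Set.range v) := subset_convexHull _ _ ⟨i, rfl⟩
  have hvi' : v (i + 1) ∈ convexHull ℝ (Set.range v) := subset_convexHull _ _ ⟨i + 1, rfl⟩
  rcases (add_nonneg ha hb).eq_or_lt with h0 | h0
  · have ha0 : a = 0 := by linarith
    have hb0 : b = 0 := by linarith
    refine ⟨0, v i, hvi, i, le_rfl, ?_, ?_⟩
    · rw [hx, ha0, hb0]; simp
    · rw [← hab, ha0, hb0, add_zero]
  · refine ⟨a + b, (a / (a + b)) • v i + (b / (a + b)) • v (i + 1),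
      convex_convexHull ℝ _ hvi hvi' (by positivity) (by positivity) (by field_simp),
      i, h0.le, ?_, hab⟩
    rw [smul_add, smul_smul, smul_smul, mul_div_cancel₀ _ h0.ne', mul_div_cancel₀ _ h0.ne', ← hx]

lemma zero_mem_hull (hm : 3 ≤ m) (h : IsConvexCycle v) :
    (0 : Plane) ∈ convexHull ℝ (Set.range v) := by
  -- A nonnegative multiple of a hull point equals `-v 0`, so the origin lies on the segment from `v
  -- 0` to that point.
  obtain ⟨s, p, hp, i, hs, hx, -⟩ := h.exists_mem_hull_smul hm (-v 0)
  have hv : v 0 ∈ convexHull ℝ (Set.range v) := subset_convexHull _ _ ⟨0, rfl⟩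
  have h1 : (0 : Plane) = (1 / (1 + s)) • v 0 + (s / (1 + s)) • p := by
    have : v 0 = -(s • p) := by rw [← hx, neg_neg]
    rw [this, smul_neg, smul_smul, one_div_mul_eq_div, neg_add_cancel]
  rw [h1]
  exact convex_convexHull ℝ _ hv hp (by positivity) (by positivity) (by field_simp)

lemma convexHull_eq (hm : 3 ≤ m) (h : IsConvexCycle v) :
    convexHull ℝ (Set.range v) = {x | ∀ k, cross x (polarCycle v k) ≤ 1} := by
  apply Set.Subset.antisymm
  · apply convexHull_min _ (convex_setOf_cross_le _)
    rintro _ ⟨j, rfl⟩ k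
    exact h.cross_le k j
  · intro x hx
    obtain ⟨s, p, hp, i, hs, rfl, hsi⟩ := h.exists_mem_hull_smul hm x
    have hs1 : s ≤ 1 := hsi.trans_le (hx i)
    have := convex_convexHull ℝ _ hp (h.zero_mem_hull hm) hs (sub_nonneg.mpr hs1) (by ring)
    simpa using this

lemma interior_convexHull (hm : 3 ≤ m) (h : IsConvexCycle v) :
    interior (convexHull ℝ (Set.range v)) = {x | ∀ k, cross x (polarCycle v k) < 1} := by
  rw [h.convexHull_eq hm]
  apply Set.Subset.antisymm
  · intro x hx k
    -- A boundary point with pairing 1 would leave the set after scaling by any t > 1.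
    have hc : ContinuousAt (fun t : ℝ => t • x) 1 := by fun_prop
    have h1 : ∀ᶠ t in nhds (1 : ℝ), t • x ∈ {x | ∀ k, cross x (polarCycle v k) ≤ 1} := by
      apply hc.eventually
      simp only [one_smul]
      exact mem_interior_iff_mem_nhds.mp hx
    have h2 : cross x (polarCycle v k) ≤ 1 := interior_subset hx k
    refine lt_of_le_of_ne h2 fun h3 => ?_
    obtain ⟨t, ht, ht1⟩ := ((h1.filter_mono nhdsWithin_le_nhds).and
      (self_mem_nhdsWithin : Set.Ioi (1 : ℝ) ∈ nhdsWithin 1 (Set.Ioi 1))).exists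
    have h4 := ht k
    rw [cross_smul_left, h3, mul_one] at h4
    exact absurd h4 (not_le.mpr ht1)
  · apply interior_maximal (fun x hx k => (hx k).le)
    rw [Set.ofPred_forall]
    refine isOpen_iInter_of_finite fun k => isOpen_lt ?_ continuous_const
    unfold cross
    fun_prop

lemma vertices_convexHull (hm : 3 ≤ m) (h : IsConvexCycle v) :
    vertices (convexHull ℝ (Set.range v)) = Set.range v := by
  apply Set.Subset.antisymm extremePoints_convexHull_subset
  rintro _ ⟨i, rfl⟩
  have hle : ∀ k, ∀ y ∈ convexHull ℝ (Set.range v), cross y (polarCycle v k) ≤ 1 := by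
    intro k y hy
    rw [h.convexHull_eq hm] at hy
    exact hy k
  exact mem_extremePoints_of_cross_le (h.polarArea_ne hm i) (hle _) (hle _)
    (subset_convexHull _ _ ⟨i, rfl⟩) (cross_polarCycle_pred h.edgeArea_ne i)
    (cross_polarCycle_self h.edgeArea_ne i)

/-- The inequalities at the vertices are exactly the half-planes describing the hull of the polar
cycle, by `polarCycle_polarCycle`. -/
lemma polarBody_convexHull (hm : 3 ≤ m) (h : IsConvexCycle v) :
    polarBody (convexHull ℝ (Set.range v)) =
      quarterTurn '' convexHull ℝ (Set.range (polarCycle v)) := by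
  rw [(h.polar hm).convexHull_eq hm]
  ext y
  obtain ⟨f, rfl⟩ := quarterTurn.surjective y
  rw [quarterTurn.injective.mem_set_image]
  simp only [polarBody, Set.mem_ofPred_eq, h.polarCycle_polarCycle hm, cross_neg_right,
    inner_quarterTurn, ← cross_comm]
  constructor
  · intro hy k
    exact hy _ (subset_convexHull _ _ ⟨k + 1, rfl⟩)
  · intro hy x hx
    have hconv : Convex ℝ {x : Plane | cross x f ≤ 1} := by
      intro x hx y hy a b ha hb hab
      rw [Set.mem_ofPred_eq, cross_add_left, cross_smul_left, cross_smul_left]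
      nlinarith [mul_le_mul_of_nonneg_left (Set.mem_ofPred_eq.mp hx) ha,
        mul_le_mul_of_nonneg_left (Set.mem_ofPred_eq.mp hy) hb]
    refine convexHull_min ?_ hconv hx
    rintro _ ⟨j, rfl⟩
    simpa using hy (j - 1)

lemma dualVertices_convexHull (hm : 3 ≤ m) (h : IsConvexCycle v) :
    dualVertices (convexHull ℝ (Set.range v)) =
      Set.range fun i => quarterTurn (polarCycle v i) := by
  have h2 := (h.polar hm).vertices_convexHull hm
  rw [vertices] at h2
  rw [dualVertices, h.polarBody_convexHull hm, ← image_extremePoints, h2, ← Set.range_comp]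
  rfl

lemma isNeighbor_iff (hm : 3 ≤ m) (h : IsConvexCycle v) (x y : Plane) :
    IsNeighbor (convexHull ℝ (Set.range v)) x y ↔
      ∃ k, (x = v k ∧ y = v (k + 1)) ∨ (x = v (k + 1) ∧ y = v k) := by
  rw [IsNeighbor, h.vertices_convexHull hm, h.dualVertices_convexHull hm]
  constructor
  · rintro ⟨⟨a, rfl⟩, ⟨b, rfl⟩, hab, _, ⟨k, rfl⟩, h1, h2⟩
    rw [inner_quarterTurn, h.cross_eq_one_iff] at h1 h2
    refine ⟨k, ?_⟩
    rcases h1 with rfl | rfl <;> rcases h2 with rfl | rfl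
    · exact absurd rfl hab
    · exact Or.inl ⟨rfl, rfl⟩
    · exact Or.inr ⟨rfl, rfl⟩
    · exact absurd rfl hab
  · rintro ⟨k, ⟨rfl, rfl⟩ | ⟨rfl, rfl⟩⟩
    · refine ⟨⟨_, rfl⟩, ⟨_, rfl⟩, fun e => succ_ne hm k (h.injective hm e).symm, _, ⟨k, rfl⟩, ?_, ?_⟩
      · rw [inner_quarterTurn, cross_polarCycle_self h.edgeArea_ne]
      · rw [inner_quarterTurn, cross_succ_polarCycle h.edgeArea_ne]
    · refine ⟨⟨_, rfl⟩, ⟨_, rfl⟩, fun e => succ_ne hm k (h.injective hm e), _, ⟨k, rfl⟩, ?_, ?_⟩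
      · rw [inner_quarterTurn, cross_succ_polarCycle h.edgeArea_ne]
      · rw [inner_quarterTurn, cross_polarCycle_self h.edgeArea_ne]

/-- The flags of a polygon, as triples made of an edge that does not contain the first vertex and
of two neighbouring vertices. -/
noncomputable def flagTriple (v : Fin m → Plane) : Fin m ⊕ Fin m → Plane × Plane × Plane :=
  Sum.elim (fun i => (quarterTurn (polarCycle v i), v (i - 1), v i))
    (fun i => (quarterTurn (polarCycle v i), v (i + 1 + 1), v (i + 1)))

/-- The third component separates the two flags of one edge; in a triangle their first two
components coincide. -/
lemma flagTriple_injective (hm : 3 ≤ m) (h : IsConvexCycle v) :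
    Function.Injective (flagTriple v) := by
  have hinj : ∀ {i j}, quarterTurn (polarCycle v i) = quarterTurn (polarCycle v j) → i = j :=
    fun e => (h.polar hm).injective hm (quarterTurn.injective e)
  rintro (i | i) (j | j) e
  · rw [hinj (congrArg Prod.fst e)]
  · obtain rfl := hinj (congrArg Prod.fst e)
    exact absurd (h.injective hm (congrArg (fun t => t.2.2) e)).symm (succ_ne hm i)
  · obtain rfl := hinj (congrArg Prod.fst e)
    exact absurd (h.injective hm (congrArg (fun t => t.2.2) e)) (succ_ne hm i)
  · rw [hinj (congrArg Prod.fst e)]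

lemma adjacentTriples_convexHull (hm : 3 ≤ m) (h : IsConvexCycle v) :
    adjacentTriples (convexHull ℝ (Set.range v)) = Set.range (flagTriple v) := by
  ext ⟨e, x, y⟩
  simp only [adjacentTriples, Set.mem_ofPred_eq, h.isNeighbor_iff hm,
    h.dualVertices_convexHull hm]
  constructor
  · rintro ⟨⟨i, rfl⟩, ⟨k, ⟨rfl, rfl⟩ | ⟨rfl, rfl⟩⟩, h1, h2⟩
    · simp only [inner_quarterTurn, h.cross_eq_one_iff, ne_eq, not_or] at h1 h2
      rcases h2 with h2 | h2
      · refine ⟨Sum.inl i, ?_⟩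
        rw [← h2]
        simp [flagTriple]
      · exact absurd (add_right_cancel h2) h1.1
    · simp only [inner_quarterTurn, h.cross_eq_one_iff, ne_eq, not_or] at h1 h2
      rcases h2 with h2 | h2
      · exact absurd (by rw [h2]) h1.2
      · refine ⟨Sum.inr i, ?_⟩
        rw [h2]
        simp [flagTriple]
  · rintro ⟨i | i, e⟩
    · simp only [flagTriple, Sum.elim_inl, Prod.mk.injEq] at e
      obtain ⟨rfl, rfl, rfl⟩ := e
      refine ⟨⟨i, rfl⟩, ⟨i - 1, Or.inl ⟨rfl, by simp⟩⟩, ?_, ?_⟩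
      · rw [inner_quarterTurn, ne_eq, h.cross_eq_one_iff]
        exact not_or.mpr ⟨pred_ne hm i, pred_ne_succ hm i⟩
      · rw [inner_quarterTurn, cross_polarCycle_self h.edgeArea_ne]
    · simp only [flagTriple, Sum.elim_inr, Prod.mk.injEq] at e
      obtain ⟨rfl, rfl, rfl⟩ := e
      refine ⟨⟨i, rfl⟩, ⟨i + 1, Or.inr ⟨rfl, rfl⟩⟩, ?_, ?_⟩
      · rw [inner_quarterTurn, ne_eq, h.cross_eq_one_iff]
        exact not_or.mpr ⟨succ_succ_ne hm i, succ_ne hm _⟩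
      · rw [inner_quarterTurn, cross_succ_polarCycle h.edgeArea_ne]

end IsConvexCycle

/-! ### The functional c₁ in vertex coordinates. -/

/-- The functional `c₁` in terms of the vertices of the polygon. -/
noncomputable def areaFunctional (v : Fin m → Plane) : ℝ :=
  ∑ i, (Real.log (cornerArea v i) - Real.log (edgeArea v i))

lemma sum_pred {M : Type*} [AddCommMonoid M] (g : Fin m → M) : ∑ i, g (i - 1) = ∑ i, g i :=
  Equiv.sum_comp (Equiv.subRight (1 : Fin m)) g

lemma sum_succ {M : Type*} [AddCommMonoid M] (g : Fin m → M) : ∑ i, g (i + 1) = ∑ i, g i :=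
  Equiv.sum_comp (Equiv.addRight (1 : Fin m)) g

namespace IsConvexCycle

/-- `Real.log` is log |·|, so products split whatever the signs. The result is symmetric in edge and
polar areas, hence invariant under polarity. -/
lemma areaFunctional_eq (hm : 3 ≤ m) (h : IsConvexCycle v) :
    areaFunctional v = ∑ i, Real.log (edgeArea v i) + ∑ i, Real.log (polarArea v i) := by
  have h1 : ∀ i, Real.log (cornerArea v i) - Real.log (edgeArea v i) =
      Real.log (edgeArea v (i - 1)) + Real.log (polarArea v i) := by
    intro i
    rw [cornerArea_eq h.edgeArea_ne, Real.log_mul (mul_ne_zero (h.edgeArea_ne _) (h.edgeArea_ne _))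
      (h.polarArea_ne hm i), Real.log_mul (h.edgeArea_ne _) (h.edgeArea_ne _)]
    ring
  rw [areaFunctional, Finset.sum_congr rfl fun i _ => h1 i, Finset.sum_add_distrib,
    sum_pred fun i => Real.log (edgeArea v i)]

lemma areaFunctional_polarCycle (hm : 3 ≤ m) (h : IsConvexCycle v) :
    areaFunctional (polarCycle v) = areaFunctional v := by
  rw [(h.polar hm).areaFunctional_eq hm, h.areaFunctional_eq hm]
  simp only [h.polarArea_polarCycle hm, edgeArea_polarCycle]
  rw [sum_succ fun i => Real.log (polarArea v i), add_comm]

/-- Over the 2m flags every edge area and every polar area occurs twice, which cancels the factor ½.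
-/
lemma secondTerm_convexHull (hm : 3 ≤ m) (h : IsConvexCycle v) :
    secondTerm (convexHull ℝ (Set.range v)) = areaFunctional v := by
  rw [secondTerm, h.adjacentTriples_convexHull hm, finsum_mem_range (h.flagTriple_injective hm),
    finsum_eq_sum_of_fintype, Fintype.sum_sum_type, h.areaFunctional_eq hm]
  simp only [flagTriple, Sum.elim_inl, Sum.elim_inr, inner_quarterTurn,
    one_sub_cross_pred h.edgeArea_ne, one_sub_cross_succ_succ h.edgeArea_ne]
  rw [sum_succ fun i => Real.log (edgeArea v i * polarArea v i)]
  simp only [Real.log_mul (h.edgeArea_ne _) (h.polarArea_ne hm _), Finset.sum_add_distrib]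
  rw [sum_pred fun i => Real.log (edgeArea v i)]
  ring

end IsConvexCycle

lemma eq_quarterTurn_polarCycle {i : Fin m} (hD : edgeArea v i ≠ 0) {e : Plane}
    (h1 : inner ℝ e (v i) = 1) (h2 : inner ℝ e (v (i + 1)) = 1) :
    e = quarterTurn (polarCycle v i) := by
  obtain ⟨f, rfl⟩ := quarterTurn.surjective e
  rw [inner_quarterTurn] at h1 h2
  congr 1
  apply eq_of_cross_eq hD
  · rw [cross_comm, h1, cross_comm, polarCycle, cross_smul_right, cross_sub_right, cross_same,
      sub_zero]
    exact congrArg _ (inv_mul_cancel₀ hD).symm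
  · rw [cross_comm, h2, cross_comm, polarCycle, cross_smul_right, cross_sub_right, cross_same,
      cross_comm _ (v i), zero_sub, neg_neg]
    exact congrArg _ (inv_mul_cancel₀ hD).symm

lemma isVertexCycle_iff (hm : 3 ≤ m) : IsVertexCycle v ↔ IsConvexCycle v := by
  constructor
  · rintro ⟨hinj, -, he⟩
    have hD : ∀ i, edgeArea v i ≠ 0 := by
      intro i h0
      obtain ⟨e, h1, h2, -⟩ := he i
      rw [finRotate_apply] at h2
      apply succ_ne hm i
      apply hinj
      rw [inner_eq_coord] at h1 h2
      rw [edgeArea, cross] at h0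
      apply plane_ext
      -- Parallel vectors on the same line ⟪e, ·⟫ = 1 coincide.
      · linear_combination (v i 0) * h2 - (v (i + 1) 0) * h1 - (e 1) * h0
      · linear_combination (v i 1) * h2 - (v (i + 1) 1) * h1 + (e 0) * h0
    refine ⟨hD, fun i j h1 h2 => ?_⟩
    obtain ⟨e, h3, h4, h5⟩ := he i
    have := h5 j h1 (by rwa [finRotate_apply])
    rwa [eq_quarterTurn_polarCycle (hD i) h3 (by rwa [finRotate_apply] at h4),
      inner_quarterTurn] at this
  · intro h
    refine ⟨h.injective hm, ?_, fun i => ⟨quarterTurn (polarCycle v i), ?_, ?_, fun j h1 h2 => ?_⟩⟩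
    · rw [h.interior_convexHull hm]
      intro k
      simp
    · rw [inner_quarterTurn, cross_polarCycle_self h.edgeArea_ne]
    · rw [inner_quarterTurn, finRotate_apply, cross_succ_polarCycle h.edgeArea_ne]
    · rw [inner_quarterTurn]
      exact h.cross_lt i j h1 (by rwa [finRotate_apply] at h2)

end Hull

/-! ### First variation of c₁ and its critical points. -/

section Variation

variable {m : ℕ} [NeZero m] {v : Fin m → Plane}

/-- The gradient of the area functional with respect to the `i`-th vertex, turned by a right
angle. -/
noncomputable def areaGradient (v : Fin m → Plane) (i : Fin m) : Plane :=
  ((edgeArea v (i - 1) * polarArea v i)⁻¹ - (edgeArea v i * polarArea v (i + 1))⁻¹) •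
      polarCycle v i +
    ((edgeArea v i * polarArea v i)⁻¹ - (edgeArea v (i - 1) * polarArea v (i - 1))⁻¹) •
      polarCycle v (i - 1)

lemma hasDerivAt_cross (a b x y : Plane) :
    HasDerivAt (fun t : ℝ => cross (a + t • x) (b + t • y)) (cross x b + cross a y) 0 := by
  have h : (fun t : ℝ => cross (a + t • x) (b + t • y)) =
      fun t => cross a b + t * (cross x b + cross a y) + t ^ 2 * cross x y := by
    funext t
    simp only [cross_add_left, cross_add_right, cross_smul_left, cross_smul_right]
    ring
  rw [h]
  have h1 : HasDerivAt (fun t : ℝ => t * (cross x b + cross a y)) (1 * (cross x b + cross a y)) 0 :=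
    (hasDerivAt_id (0 : ℝ)).mul_const _
  have h2 : HasDerivAt (fun t : ℝ => t ^ 2 * cross x y) (2 * (0 : ℝ) * cross x y) 0 := by
    simpa using ((hasDerivAt_id (0 : ℝ)).pow 2).mul_const (cross x y)
  have h3 := (h1.const_add (cross a b)).add h2
  rw [one_mul, mul_zero, zero_mul, add_zero] at h3
  exact h3

namespace IsConvexCycle

lemma hasDerivAt_areaFunctional (hm : 3 ≤ m) (h : IsConvexCycle v) (δ : Fin m → Plane) :
    HasDerivAt (fun t : ℝ => areaFunctional (v + t • δ)) (∑ i, cross (δ i) (areaGradient v i)) 0 := by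
  set D := edgeArea v with hD
  set E := polarArea v with hE
  set f := polarCycle v with hf
  have hDn : ∀ i, D i ≠ 0 := h.edgeArea_ne
  have hEn : ∀ i, E i ≠ 0 := h.polarArea_ne hm
  have hA : ∀ i, cornerArea v i = D (i - 1) * D i * E i := cornerArea_eq h.edgeArea_ne
  let dA : Fin m → ℝ := fun i => cross (δ (i - 1)) (v i) + cross (v (i - 1)) (δ i) +
    (cross (δ i) (v (i + 1)) + cross (v i) (δ (i + 1))) +
    (cross (δ (i + 1)) (v (i - 1)) + cross (v (i + 1)) (δ (i - 1)))
  let dD : Fin m → ℝ := fun i => cross (δ i) (v (i + 1)) + cross (v i) (δ (i + 1))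
  have h1 : HasDerivAt (fun t : ℝ => areaFunctional (v + t • δ))
      (∑ i, (dA i / cornerArea v i - dD i / D i)) 0 := by
    unfold areaFunctional
    refine HasDerivAt.fun_sum fun i _ => ?_
    have hcorner : HasDerivAt (fun t : ℝ => cornerArea (v + t • δ) i) (dA i) 0 :=
      ((hasDerivAt_cross _ _ _ _).add (hasDerivAt_cross _ _ _ _)).add (hasDerivAt_cross _ _ _ _)
    have hedge : HasDerivAt (fun t : ℝ => edgeArea (v + t • δ) i) (dD i) 0 :=
      hasDerivAt_cross _ _ _ _
    have hc0 : cornerArea (v + (0 : ℝ) • δ) i ≠ 0 := by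
      rw [zero_smul, add_zero, hA]
      exact mul_ne_zero (mul_ne_zero (hDn _) (hDn _)) (hEn _)
    have he0 : edgeArea (v + (0 : ℝ) • δ) i ≠ 0 := by
      rw [zero_smul, add_zero]
      exact hDn i
    have := (hcorner.log hc0).sub (hedge.log he0)
    rw [zero_smul, add_zero] at this
    exact this
  convert h1 using 1
  -- The derivative of the i-th summand and the gradient at the i-th vertex differ only by index
  -- shifts of `p`, `q`, `r`, which vanish in the cyclic sum.
  let p : Fin m → ℝ := fun i => cross (δ i) (f (i + 1)) / (D i * E (i + 1))
  let q : Fin m → ℝ := fun i => cross (δ (i + 1)) (f (i - 1)) / (D i * E i)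
  let r : Fin m → ℝ := fun i => cross (δ (i + 1)) (v i) / D i
  let s : Fin m → ℝ := fun i => cross (δ i) (f i) / (D (i - 1) * E i) +
    cross (δ i) (f (i - 1)) / (D i * E i) - cross (δ i) (v (i + 1)) / D i
  have h2 : ∀ i, dA i / cornerArea v i - dD i / D i = s i - p (i - 1) - q i + r i := by
    intro i
    have e1 : v (i + 1) = v i + D i • f i := succ_eq_add_smul h.edgeArea_ne i
    have e2 : v (i - 1) = v i - D (i - 1) • f (i - 1) := pred_eq_sub_smul h.edgeArea_ne i
    have n1 := hDn i
    have n2 := hDn (i - 1)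
    have n3 := hEn i
    simp only [dA, dD, s, p, q, r, hA, sub_add_cancel, e1, e2]
    field_simp
    simp [cross]
    ring
  have h3 : ∀ i, cross (δ i) (areaGradient v i) = s i - p i - q (i - 1) + r (i - 1) := by
    intro i
    have e3 : f (i + 1) = f i - E (i + 1) • v (i + 1) := polarCycle_succ h.edgeArea_ne i
    have e4 : f (i - 1 - 1) = f (i - 1) + E (i - 1) • v (i - 1) := by
      have := polarCycle_eq_sub h.edgeArea_ne (i - 1)
      rw [← hf, ← hE] at this
      rw [this]; abel
    have n1 := hDn i
    have n2 := hDn (i - 1)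
    have n3 := hEn i
    have n4 := hEn (i - 1)
    have n5 := hEn (i + 1)
    simp only [areaGradient, s, p, q, r, sub_add_cancel, e3, e4, ← hD, ← hE, ← hf,
      cross_add_right, cross_sub_right, cross_smul_right]
    field_simp
    ring
  rw [Finset.sum_congr rfl fun i _ => h2 i, Finset.sum_congr rfl fun i _ => h3 i]
  simp only [Finset.sum_add_distrib, Finset.sum_sub_distrib]
  rw [sum_pred p, sum_pred q, sum_pred r]

end IsConvexCycle

lemma ofNat_succ (n : ℕ) : Fin.ofNat m (n + 1) = Fin.ofNat m n + 1 := by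
  apply Fin.ext
  simp [Fin.val_add]

lemma ofNat_val (i : Fin m) : Fin.ofNat m i.val = i := by
  apply Fin.ext
  simp

lemma eq_of_succ_eq {α : Type*} {g : Fin m → α} (hg : ∀ i, g (i + 1) = g i) (i : Fin m) :
    g i = g 0 := by
  have h : ∀ n : ℕ, g (Fin.ofNat m n) = g 0 := by
    intro n
    induction n with
    | zero => rfl
    | succ n ih => rw [ofNat_succ, hg, ih]
  simpa [ofNat_val] using h i.val

namespace IsConvexCycle

/-- At a critical point all the areas are equal. -/
lemma areas_const_of_areaGradient_eq_zero (hm : 3 ≤ m) (h : IsConvexCycle v)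
    (h0 : ∀ i, areaGradient v i = 0) :
    (∀ i, edgeArea v i = edgeArea v 0) ∧ ∀ i, polarArea v i = polarArea v 0 := by
  set D := edgeArea v with hD
  set E := polarArea v with hE
  -- The two polar vertices in the gradient are independent, so both coefficients vanish.
  have hcoef : ∀ i, (D (i - 1) * E i)⁻¹ - (D i * E (i + 1))⁻¹ = 0 ∧
      (D i * E i)⁻¹ - (D (i - 1) * E (i - 1))⁻¹ = 0 := by
    intro i
    have hi := h0 i
    rw [areaGradient, ← hD, ← hE] at hi
    have hn : cross (polarCycle v (i - 1)) (polarCycle v i) ≠ 0 := h.polarArea_ne hm i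
    constructor
    · have := congrArg (cross (polarCycle v (i - 1))) hi
      rw [cross_add_right, cross_smul_right, cross_smul_right, cross_same, mul_zero, add_zero,
        cross_zero_right] at this
      exact (mul_eq_zero.mp this).resolve_right hn
    · have := congrArg (fun x => cross x (polarCycle v i)) hi
      simp only [cross_add_left, cross_smul_left, cross_same, mul_zero, zero_add,
        cross_zero_left] at this
      exact (mul_eq_zero.mp this).resolve_right hn
  have ha : ∀ i, D i * E i = D 0 * E 0 := by
    apply eq_of_succ_eq (g := fun i => D i * E i)
    intro i
    have := (hcoef (i + 1)).2
    rw [add_sub_cancel_right, sub_eq_zero] at this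
    exact inv_injective this
  have hb : ∀ i, D i * E (i + 1) = D 0 * E (0 + 1) := by
    apply eq_of_succ_eq (g := fun i => D i * E (i + 1))
    intro i
    have := (hcoef (i + 1)).1
    rw [add_sub_cancel_right, sub_eq_zero] at this
    exact (inv_injective this).symm
  have hapos : 0 < D 0 * E 0 := h.edgeArea_mul_polarArea_pos hm 0
  have hbpos : 0 < D 0 * E (0 + 1) := h.edgeArea_mul_polarArea_succ_pos hm 0
  set a := D 0 * E 0
  set b := D 0 * E (0 + 1)
  have hstep : ∀ i, a * E (i + 1) = b * E i := by
    intro i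
    rw [← ha i, ← hb i]
    ring
  -- `E` is geometric with ratio b/a along a closed cycle; the shift-invariant sum of squares gives
  -- a² = b².
  have hsum : a ^ 2 * ∑ i, E i ^ 2 = b ^ 2 * ∑ i, E i ^ 2 := by
    rw [← sum_succ fun i => E i ^ 2, Finset.mul_sum, sum_succ fun i => E i ^ 2, Finset.mul_sum]
    refine Finset.sum_congr rfl fun i _ => ?_
    rw [← mul_pow, hstep i, mul_pow]
  have hpos : 0 < ∑ i, E i ^ 2 :=
    Finset.sum_pos (fun i _ => sq_pos_of_ne_zero (h.polarArea_ne hm i)) Finset.univ_nonempty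
  have hab : a = b := by
    have := mul_right_cancel₀ hpos.ne' hsum
    exact (pow_left_inj₀ hapos.le hbpos.le two_ne_zero).mp this
  have hEc : ∀ i, E i = E 0 := by
    apply eq_of_succ_eq
    intro i
    have := hstep i
    rw [← hab] at this
    exact mul_left_cancel₀ hapos.ne' this
  refine ⟨fun i => ?_, hEc⟩
  have := ha i
  rw [hEc i] at this
  exact mul_right_cancel₀ (h.polarArea_ne hm 0) this

/-- If the gradient is the same at all vertices and the vertices sum up to zero, then the gradient
vanishes. -/
lemma areaGradient_eq_zero_of_const (hm : 3 ≤ m) (h : IsConvexCycle v) (hs : ∑ i, v i = 0)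
    {ξ : Plane} (hξ : ∀ i, areaGradient v i = ξ) : ξ = 0 := by
  set D := edgeArea v with hD
  set E := polarArea v with hE
  set f := polarCycle v with hf
  have hDn : ∀ i, D i ≠ 0 := h.edgeArea_ne
  have hEn : ∀ i, E i ≠ 0 := h.polarArea_ne hm
  let W : Fin m → ℝ := fun i => (D i * E i)⁻¹ - (D i * E (i + 1))⁻¹
  have h1 : ∀ i, cross (v i) ξ = W i - W (i - 1) := by
    intro i
    rw [← hξ i, areaGradient, cross_add_right, cross_smul_right, cross_smul_right,
      cross_polarCycle_self h.edgeArea_ne, cross_polarCycle_pred h.edgeArea_ne, ← hD, ← hE]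
    simp only [W, sub_add_cancel]
    ring
  -- Two summations by parts, via `v (i + 1) - v i = D i • f i` and `f (i - 1) - f i = E i • v i`,
  -- turn the sum of squares into the linear sum, which is zero by `hs`.
  have h2 : ∑ i, cross (v i) ξ * cross (v i) ξ = 0 := by
    have e1 : ∀ i, cross (v i) ξ * cross (v i) ξ =
        W i * cross (v i) ξ - W (i - 1) * cross (v (i - 1 + 1)) ξ := by
      intro i
      rw [sub_add_cancel, ← sub_mul, ← h1 i]
    rw [Finset.sum_congr rfl fun i _ => e1 i, Finset.sum_sub_distrib,
      sum_pred fun i => W i * cross (v (i + 1)) ξ, ← Finset.sum_sub_distrib]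
    have e2 : ∀ i, W i * cross (v i) ξ - W i * cross (v (i + 1)) ξ =
        (E (i + 1))⁻¹ * cross (f (i + 1 - 1)) ξ - (E i)⁻¹ * cross (f i) ξ := by
      intro i
      rw [succ_eq_add_smul h.edgeArea_ne, cross_add_left, cross_smul_left, ← hD, ← hf,
        add_sub_cancel_right]
      simp only [W]
      have := hDn i
      have := hEn i
      have := hEn (i + 1)
      field_simp
      ring
    rw [Finset.sum_congr rfl fun i _ => e2 i, Finset.sum_sub_distrib,
      sum_succ fun i => (E i)⁻¹ * cross (f (i - 1)) ξ, ← Finset.sum_sub_distrib]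
    have e3 : ∀ i, (E i)⁻¹ * cross (f (i - 1)) ξ - (E i)⁻¹ * cross (f i) ξ = cross (v i) ξ := by
      intro i
      have e4 : f i = f (i - 1) - E i • v i := polarCycle_eq_sub h.edgeArea_ne i
      rw [e4, cross_sub_left, cross_smul_left]
      have := hEn i
      field_simp
      ring
    rw [Finset.sum_congr rfl fun i _ => e3 i, ← cross_sum_left, hs, cross_zero_left]
  have h3 : ∀ i, cross (v i) ξ = 0 := by
    intro i
    have := (Finset.sum_eq_zero_iff_of_nonneg fun i _ => mul_self_nonneg _).mp h2 i
      (Finset.mem_univ i)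
    exact mul_self_eq_zero.mp this
  refine eq_of_cross_eq (hDn 0) ?_ ?_
  · rw [cross_comm, h3, neg_zero, cross_zero_left]
  · rw [cross_comm, h3, neg_zero, cross_zero_left]

lemma cross_quarterTurn (x : Plane) : cross (quarterTurn x) x = x 0 ^ 2 + x 1 ^ 2 := by
  simp [cross, quarterTurn]; ring

lemma cross_quarterTurn_nonneg (x : Plane) : 0 ≤ cross (quarterTurn x) x := by
  rw [cross_quarterTurn]; positivity

lemma eq_zero_of_cross_quarterTurn {x : Plane} (h : cross (quarterTurn x) x = 0) : x = 0 := by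
  rw [cross_quarterTurn] at h
  apply plane_ext
  · exact pow_eq_zero_iff two_ne_zero |>.mp (by nlinarith [sq_nonneg (x 0), sq_nonneg (x 1)])
  · exact pow_eq_zero_iff two_ne_zero |>.mp (by nlinarith [sq_nonneg (x 0), sq_nonneg (x 1)])

lemma eq_zero_of_sum_cross {ι : Type*} [Fintype ι] {X : ι → Plane}
    (h : ∀ δ : ι → Plane, ∑ i, cross (δ i) (X i) = 0) (i : ι) : X i = 0 := by
  have h1 := h fun i => quarterTurn (X i)
  exact eq_zero_of_cross_quarterTurn
    ((Finset.sum_eq_zero_iff_of_nonneg fun i _ => cross_quarterTurn_nonneg _).mp h1 i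
      (Finset.mem_univ i))

/-- Lagrange multiplier for the constraint of zero sum: ξ is the mean of `X`, and the admissible
test variation is the quarter turn of `X - ξ`. -/
lemma exists_eq_of_sum_cross {X : Fin m → Plane}
    (h : ∀ δ : Fin m → Plane, ∑ i, δ i = 0 → ∑ i, cross (δ i) (X i) = 0) :
    ∃ ξ, ∀ i, X i = ξ := by
  set ξ : Plane := (m : ℝ)⁻¹ • ∑ i, X i with hξ
  have hm0 : (m : ℝ) ≠ 0 := Nat.cast_ne_zero.mpr (NeZero.ne m)
  have hs : ∑ i, (X i - ξ) = 0 := by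
    rw [Finset.sum_sub_distrib, Finset.sum_const, Finset.card_univ, Fintype.card_fin,
      ← Nat.cast_smul_eq_nsmul ℝ, hξ, smul_smul, mul_inv_cancel₀ hm0, one_smul, sub_self]
  have hs' : ∑ i, quarterTurn (X i - ξ) = 0 := by rw [← map_sum, hs, map_zero]
  have h1 := h (fun i => quarterTurn (X i - ξ)) hs'
  have h2 : ∑ i, cross (quarterTurn (X i - ξ)) (X i - ξ) = 0 := by
    simp only [cross_sub_right _ _ ξ, Finset.sum_sub_distrib]
    rw [h1, ← cross_sum_left, hs', cross_zero_left, sub_zero]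
  refine ⟨ξ, fun i => sub_eq_zero.mp (eq_zero_of_cross_quarterTurn ?_)⟩
  exact (Finset.sum_eq_zero_iff_of_nonneg fun i _ => cross_quarterTurn_nonneg _).mp h2 i
    (Finset.mem_univ i)

lemma eventually_nhds (h : IsConvexCycle v) : ∀ᶠ w in nhds v, IsConvexCycle w := by
  have hc : ∀ i : Fin m, Continuous fun w : Fin m → Plane => edgeArea w i := by
    intro i
    unfold edgeArea cross
    fun_prop
  have h1 : ∀ᶠ w in nhds v, ∀ i, edgeArea w i ≠ 0 :=
    Filter.eventually_all.mpr fun i => (hc i).continuousAt.eventually_ne (h.edgeArea_ne i)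
  have h2 : ∀ᶠ w in nhds v, ∀ i j, j ≠ i → j ≠ i + 1 → cross (w j) (polarCycle w i) < 1 := by
    refine Filter.eventually_all.mpr fun i => Filter.eventually_all.mpr fun j => ?_
    by_cases hj : j ≠ i ∧ j ≠ i + 1
    · have hca : ContinuousAt (fun w : Fin m → Plane => cross (w j) (polarCycle w i)) v := by
        simp only [polarCycle, cross_smul_right]
        refine ContinuousAt.mul ((hc i).continuousAt.inv₀ (h.edgeArea_ne i)) ?_
        unfold cross
        fun_prop
      filter_upwards [hca.eventually (gt_mem_nhds (h.cross_lt i j hj.1 hj.2))] with w hw _ _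
      exact hw
    · exact Filter.Eventually.of_forall fun w a b => absurd ⟨a, b⟩ hj
  filter_upwards [h1, h2] with w hw1 hw2
  exact ⟨hw1, hw2⟩

lemma areas_const_of_hasFDerivAt (hm : 3 ≤ m) (h : IsConvexCycle v)
    (hd : HasFDerivAt (fun w : Fin m → Plane => secondTerm (convexHull ℝ (Set.range w)))
      (0 : (Fin m → Plane) →L[ℝ] ℝ) v) :
    (∀ i, edgeArea v i = edgeArea v 0) ∧ ∀ i, polarArea v i = polarArea v 0 := by
  apply h.areas_const_of_areaGradient_eq_zero hm
  apply eq_zero_of_sum_cross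
  intro δ
  have hd' : HasFDerivAt areaFunctional (0 : (Fin m → Plane) →L[ℝ] ℝ) v := by
    apply hd.congr_of_eventuallyEq
    filter_upwards [h.eventually_nhds] with w hw
    exact (hw.secondTerm_convexHull hm).symm
  have hl : HasDerivAt (fun t : ℝ => v + t • δ) δ 0 := by
    simpa using ((hasDerivAt_id (0 : ℝ)).smul_const δ).const_add v
  have hd0 : HasFDerivAt areaFunctional (0 : (Fin m → Plane) →L[ℝ] ℝ) (v + (0 : ℝ) • δ) := by
    simpa using hd'
  have hcomp := hd0.comp_hasDerivAt 0 hl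
  exact (h.hasDerivAt_areaFunctional hm δ).unique hcomp

/-- A maximum among the cycles with vertex sum zero is a critical point. -/
lemma areas_const_of_forall_le (hm : 3 ≤ m) (h : IsConvexCycle v) (hs : ∑ i, v i = 0)
    (hmax : ∀ w : Fin m → Plane, IsConvexCycle w → ∑ i, w i = 0 →
      areaFunctional w ≤ areaFunctional v) :
    (∀ i, edgeArea v i = edgeArea v 0) ∧ ∀ i, polarArea v i = polarArea v 0 := by
  apply h.areas_const_of_areaGradient_eq_zero hm
  obtain ⟨ξ, hξ⟩ : ∃ ξ, ∀ i, areaGradient v i = ξ := by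
    apply exists_eq_of_sum_cross
    intro δ hδ
    refine IsLocalMax.hasDerivAt_eq_zero ?_ (h.hasDerivAt_areaFunctional hm δ)
    have hc : ContinuousAt (fun t : ℝ => v + t • δ) 0 := by fun_prop
    have : ∀ᶠ t in nhds (0 : ℝ), IsConvexCycle (v + t • δ) := by
      apply hc.eventually
      simpa using h.eventually_nhds
    filter_upwards [this] with t ht
    simp only [zero_smul, add_zero]
    apply hmax _ ht
    simp [Finset.sum_add_distrib, hs, ← Finset.smul_sum, hδ]
  obtain rfl := h.areaGradient_eq_zero_of_const hm hs hξ
  exact hξ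

end IsConvexCycle

end Variation

/-! ### Regular polygons and cycles with constant areas. -/

section Regular

/-- The parametrization of an ellipse with conjugate half-diameters `p` and `q`. -/
noncomputable def ellipse (p q : Plane) (t : ℝ) : Plane := Real.cos t • p + Real.sin t • q

lemma cross_ellipse (p q : Plane) (s t : ℝ) :
    cross (ellipse p q s) (ellipse p q t) = Real.sin (t - s) * cross p q := by
  simp only [ellipse, cross_add_left, cross_add_right, cross_smul_left, cross_smul_right,
    cross_same, cross_comm q p, Real.sin_sub]
  ring

lemma ellipse_add_two_pi_mul (p q : Plane) (t : ℝ) (n : ℕ) :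
    ellipse p q (t + n * (2 * Real.pi)) = ellipse p q t := by
  rw [ellipse, ellipse, Real.cos_add_nat_mul_two_pi, Real.sin_add_nat_mul_two_pi]

lemma sin_add_sin_sub_sin (u w : ℝ) : Real.sin (2 * u) + Real.sin (2 * w - 2 * u) - Real.sin (2 * w) =
    4 * Real.sin u * Real.sin w * Real.sin (w - u) := by
  rw [Real.sin_sub, Real.sin_sub, Real.sin_two_mul, Real.sin_two_mul, Real.cos_two_mul,
    Real.cos_two_mul]
  linear_combination 4 * (Real.sin w * Real.cos w) * Real.sin_sq_add_cos_sq u -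
    4 * (Real.sin u * Real.cos u) * Real.sin_sq_add_cos_sq w

/-- The product form exposes the sign of the area; it serves both to prove regular cycles convex and
to identify the angle of a constant-area cycle. -/
lemma triArea_ellipse (p q : Plane) (θ x y : ℝ) :
    triArea (ellipse p q (x * θ)) (ellipse p q ((x + 1) * θ)) (ellipse p q (y * θ)) =
      4 * Real.sin (θ / 2) * Real.sin ((y - x) * (θ / 2)) * Real.sin ((y - x - 1) * (θ / 2)) *
        cross p q := by
  have h := sin_add_sin_sub_sin (θ / 2) ((y - x) * (θ / 2))
  rw [show (y - x - 1) * (θ / 2) = (y - x) * (θ / 2) - θ / 2 by ring, ← h, triArea, cross_ellipse,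
    cross_ellipse, cross_ellipse, show (x + 1) * θ - x * θ = 2 * (θ / 2) by ring,
    show y * θ - (x + 1) * θ = 2 * ((y - x) * (θ / 2)) - 2 * (θ / 2) by ring,
    show x * θ - y * θ = -(2 * ((y - x) * (θ / 2))) by ring, Real.sin_neg]
  ring

/-- The angle between consecutive vertices of the regular `m`-gon. -/
noncomputable def regAngle (m : ℕ) : ℝ := 2 * Real.pi / m

/-- The linear image of the regular `m`-gon that sends the standard basis to `p`, `q`. -/
noncomputable def regCycle {m : ℕ} (p q : Plane) (i : Fin m) : Plane := ellipse p q (i.val * regAngle m)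

lemma regularPolygon_eq (m : ℕ) : regularPolygon m =
    convexHull ℝ (Set.range (regCycle (m := m) !₂[1, 0] !₂[0, 1])) := by
  rw [regularPolygon]
  congr 2
  funext k
  have : 2 * Real.pi * (k.val : ℝ) / m = k.val * regAngle m := by rw [regAngle]; ring
  apply plane_ext <;> simp [regCycle, ellipse, this]

lemma image_regularPolygon (m : ℕ) (g : Plane →ₗ[ℝ] Plane) : g '' regularPolygon m =
    convexHull ℝ (Set.range (regCycle (m := m) (g !₂[1, 0]) (g !₂[0, 1]))) := by
  rw [regularPolygon_eq, g.image_convexHull, ← Set.range_comp]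
  congr 2
  funext k
  simp [regCycle, ellipse]

variable {m : ℕ} [NeZero m] {v : Fin m → Plane}

lemma mul_regAngle (m : ℕ) [NeZero m] : m * regAngle m = 2 * Real.pi := by
  have : (m : ℝ) ≠ 0 := Nat.cast_ne_zero.mpr (NeZero.ne m)
  rw [regAngle]
  field_simp

lemma regAngle_pos (m : ℕ) [NeZero m] : 0 < regAngle m := by
  have : (0 : ℝ) < m := Nat.cast_pos.mpr (NeZero.pos m)
  have := Real.pi_pos
  rw [regAngle]
  positivity

lemma regAngle_lt_pi (hm : 3 ≤ m) : regAngle m < Real.pi := by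
  have h3 : (3 : ℝ) ≤ m := by exact_mod_cast hm
  have := mul_regAngle m
  nlinarith [regAngle_pos m, Real.pi_pos]

lemma regCycle_ofNat (p q : Plane) (n : ℕ) :
    regCycle p q (Fin.ofNat m n) = ellipse p q (n * regAngle m) := by
  rw [regCycle, Fin.val_ofNat, ← ellipse_add_two_pi_mul p q _ (n / m), ← mul_regAngle m]
  congr 1
  have : ((n % m : ℕ) : ℝ) + m * ((n / m : ℕ) : ℝ) = n := by exact_mod_cast Nat.mod_add_div n m
  linear_combination regAngle m * this

lemma regCycle_succ (p q : Plane) (i : Fin m) :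
    regCycle p q (i + 1) = ellipse p q ((i.val + 1) * regAngle m) := by
  have := regCycle_ofNat (m := m) p q (i.val + 1)
  rw [ofNat_succ, ofNat_val] at this
  rw [this]
  push_cast
  rfl

lemma regCycle_succ_succ (p q : Plane) (i : Fin m) :
    regCycle p q (i + 1 + 1) = ellipse p q ((i.val + 2) * regAngle m) := by
  have := regCycle_ofNat (m := m) p q (i.val + 1 + 1)
  rw [ofNat_succ, ofNat_succ, ofNat_val] at this
  rw [this]
  push_cast
  congr 2
  ring

lemma edgeArea_regCycle (p q : Plane) (i : Fin m) :
    edgeArea (regCycle p q) i = Real.sin (regAngle m) * cross p q := by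
  rw [edgeArea, regCycle_succ, regCycle, cross_ellipse]
  congr 2
  ring

lemma one_sub_cross_polarCycle {i : Fin m} (hD : edgeArea v i ≠ 0) (j : Fin m) :
    1 - cross (v j) (polarCycle v i) = triArea (v i) (v (i + 1)) (v j) / edgeArea v i := by
  rw [polarCycle, cross_smul_right, eq_div_iff hD, sub_mul, mul_right_comm, inv_mul_cancel₀ hD,
    cross_sub_right, triArea, edgeArea, cross_comm (v (i + 1)) (v j)]
  ring

lemma isConvexCycle_regCycle (hm : 3 ≤ m) {p q : Plane} (hpq : cross p q ≠ 0) :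
    IsConvexCycle (regCycle (m := m) p q) := by
  have hpos := regAngle_pos m
  have hlt := regAngle_lt_pi hm
  have hm2 := mul_regAngle m
  have hsin : 0 < Real.sin (regAngle m) := Real.sin_pos_of_pos_of_lt_pi hpos hlt
  have hsin2 : 0 < Real.sin (regAngle m / 2) :=
    Real.sin_pos_of_pos_of_lt_pi (by linarith) (by linarith)
  have hD : ∀ i, edgeArea (regCycle (m := m) p q) i ≠ 0 := by
    intro i
    rw [edgeArea_regCycle]
    exact mul_ne_zero hsin.ne' hpq
  refine ⟨hD, fun i j h1 h2 => ?_⟩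
  rw [← sub_pos, one_sub_cross_polarCycle (hD i), edgeArea_regCycle, regCycle_succ, regCycle,
    regCycle, triArea_ellipse, mul_div_mul_right _ _ hpq]
  apply div_pos _ hsin
  rw [mul_assoc]
  refine mul_pos (by positivity) ?_
  have hi : (i.val : ℝ) + 1 ≤ m := by exact_mod_cast i.isLt
  have hj : (j.val : ℝ) + 1 ≤ m := by exact_mod_cast j.isLt
  have hi0 : (0 : ℝ) ≤ i.val := Nat.cast_nonneg _
  have hj0 : (0 : ℝ) ≤ j.val := Nat.cast_nonneg _
  rcases lt_or_gt_of_ne (fun e => h1 (Fin.ext e) : j.val ≠ i.val) with hlt' | hgt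
  · have h3 : (j.val : ℝ) + 1 ≤ i.val := by exact_mod_cast hlt'
    have h4 : (i.val : ℝ) + 2 ≤ j.val + m := by
      have : i.val + 1 ≠ j.val + m := by
        intro e
        apply h2
        have h5 := congrArg (Fin.ofNat m) e
        rw [ofNat_succ, ofNat_val] at h5
        rw [h5]
        apply Fin.ext
        simp [Nat.mod_eq_of_lt j.isLt]
      have : i.val + 2 ≤ j.val + m := by have := i.isLt; omega
      exact_mod_cast this
    apply mul_pos_of_neg_of_neg <;> apply Real.sin_neg_of_neg_of_neg_pi_lt <;> nlinarith
  · have h3 : (i.val : ℝ) + 2 ≤ j.val := by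
      have : j.val ≠ i.val + 1 := by
        intro e
        apply h2
        rw [← ofNat_val j, e, ofNat_succ, ofNat_val]
      have : i.val + 2 ≤ j.val := by omega
      exact_mod_cast this
    apply mul_pos <;> apply Real.sin_pos_of_pos_of_lt_pi <;> nlinarith

lemma two_sub_two_cos_pos (hm : 3 ≤ m) : 0 < 2 - 2 * Real.cos (regAngle m) := by
  have := Real.cos_lt_cos_of_nonneg_of_le_pi le_rfl (regAngle_lt_pi hm).le (regAngle_pos m)
  rw [Real.cos_zero] at this
  linarith

lemma areaFunctional_regCycle (hm : 3 ≤ m) {p q : Plane} (hpq : cross p q ≠ 0) :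
    areaFunctional (regCycle (m := m) p q) = m * Real.log (2 - 2 * Real.cos (regAngle m)) := by
  have hsin : 0 < Real.sin (regAngle m) :=
    Real.sin_pos_of_pos_of_lt_pi (regAngle_pos m) (regAngle_lt_pi hm)
  rw [areaFunctional, ← sum_succ]
  have h1 : ∀ i : Fin m, Real.log (cornerArea (regCycle p q) (i + 1)) -
      Real.log (edgeArea (regCycle p q) (i + 1)) = Real.log (2 - 2 * Real.cos (regAngle m)) := by
    intro i
    have : cornerArea (regCycle (m := m) p q) (i + 1) =
        (2 - 2 * Real.cos (regAngle m)) * (Real.sin (regAngle m) * cross p q) := by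
      rw [cornerArea, add_sub_cancel_right, regCycle_succ_succ, regCycle_succ, regCycle, triArea,
        cross_ellipse, cross_ellipse, cross_ellipse]
      rw [show ((i.val : ℝ) + 1) * regAngle m - i.val * regAngle m = regAngle m by ring,
        show ((i.val : ℝ) + 2) * regAngle m - (i.val + 1) * regAngle m = regAngle m by ring,
        show (i.val : ℝ) * regAngle m - (i.val + 2) * regAngle m = -(2 * regAngle m) by ring,
        Real.sin_neg, Real.sin_two_mul]
      ring
    rw [this, edgeArea_regCycle, Real.log_mul (two_sub_two_cos_pos hm).ne'
      (mul_ne_zero hsin.ne' hpq)]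
    ring
  rw [Finset.sum_congr rfl fun i _ => h1 i]
  simp

lemma sum_polarCycle_regCycle (p q : Plane) :
    ∑ i, polarCycle (regCycle (m := m) p q) i = 0 := by
  simp only [polarCycle, edgeArea_regCycle]
  rw [← Finset.smul_sum, Finset.sum_sub_distrib, sum_succ, sub_self, smul_zero]

lemma cross_ne_zero_of_linearEquiv (g : Plane ≃ₗ[ℝ] Plane) {a b : Plane} (hab : cross a b ≠ 0) :
    cross (g a) (g b) ≠ 0 := by
  intro h0
  have key : ∀ k : Fin 2, (g b k) • a - (g a k) • b = 0 := by
    intro k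
    apply g.injective
    rw [map_sub, map_smul, map_smul, map_zero]
    rw [cross] at h0
    fin_cases k <;> apply plane_ext <;> simp <;> linarith
  have h1 : ∀ k, g a k = 0 := by
    intro k
    have := congrArg (cross a) (key k)
    rw [cross_sub_right, cross_smul_right, cross_smul_right, cross_same, cross_zero_right,
      mul_zero, zero_sub, neg_eq_zero] at this
    exact (mul_eq_zero.mp this).resolve_right hab
  have h2 : a = 0 := g.injective (by rw [map_zero]; exact plane_ext (h1 0) (h1 1))
  rw [h2] at hab
  exact hab (cross_zero_left b)

/-- The linear map that sends the standard basis to `p`, `q`. -/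
noncomputable def basisMap (p q : Plane) : Plane →ₗ[ℝ] Plane where
  toFun x := x 0 • p + x 1 • q
  map_add' a b := by simp only [PiLp.add_apply]; module
  map_smul' r a := by simp only [PiLp.smul_apply, smul_eq_mul, RingHom.id_apply]; module

lemma basisMap_injective {p q : Plane} (hpq : cross p q ≠ 0) :
    Function.Injective (basisMap p q) := by
  rw [injective_iff_map_eq_zero]
  intro x hx
  have h1 := congrArg (fun y => cross y q) hx
  have h2 := congrArg (cross p) hx
  simp only [basisMap, LinearMap.coe_mk, AddHom.coe_mk, cross_add_left, cross_add_right,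
    cross_smul_left, cross_smul_right, cross_same, mul_zero, add_zero, zero_add, cross_zero_left,
    cross_zero_right] at h1 h2
  exact plane_ext ((mul_eq_zero.mp h1).resolve_right hpq) ((mul_eq_zero.mp h2).resolve_right hpq)

lemma isLinearImageOfRegular_iff {n : ℕ} {P : Set Plane} : IsLinearImageOfRegular n P ↔
    ∃ p q : Plane, cross p q ≠ 0 ∧ P = convexHull ℝ (Set.range (regCycle (m := n) p q)) := by
  constructor
  · rintro ⟨g, rfl⟩
    refine ⟨g !₂[1, 0], g !₂[0, 1], cross_ne_zero_of_linearEquiv g (by simp [cross]), ?_⟩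
    exact image_regularPolygon n g.toLinearMap
  · rintro ⟨p, q, hpq, rfl⟩
    refine ⟨LinearEquiv.ofInjectiveEndo (basisMap p q) (basisMap_injective hpq), ?_⟩
    rw [LinearEquiv.coe_ofInjectiveEndo, image_regularPolygon]
    congr 4 <;> simp [basisMap]

namespace IsConvexCycle

/-- The recurrence satisfied by a cycle with constant areas. -/
lemma succ_add_pred_of_const (h : IsConvexCycle v)
    (hD : ∀ i, edgeArea v i = edgeArea v 0) (hE : ∀ i, polarArea v i = polarArea v 0)
    (i : Fin m) : v (i + 1) + v (i - 1) = (2 - edgeArea v 0 * polarArea v 0) • v i := by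
  rw [succ_eq_add_smul h.edgeArea_ne, pred_eq_sub_smul h.edgeArea_ne,
    polarCycle_eq_sub h.edgeArea_ne i, hD i, hD (i - 1), hE i]
  module

/-- Summing the recurrence gives Σ |v_i + v_{i+1}|² = (4 - a) Σ |v_i|², and the left side is
positive because consecutive vertices are independent. This makes the step angle real. -/
lemma lt_four_of_const (h : IsConvexCycle v)
    (hD : ∀ i, edgeArea v i = edgeArea v 0) (hE : ∀ i, polarArea v i = polarArea v 0) :
    edgeArea v 0 * polarArea v 0 < 4 := by
  set a := edgeArea v 0 * polarArea v 0 with ha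
  set N := ∑ i, inner ℝ (v i) (v i) with hN
  set C := ∑ i, inner ℝ (v i) (v (i + 1)) with hC
  have h1 : C + C = (2 - a) * N := by
    have e1 : C = ∑ i, inner ℝ (v i) (v (i - 1)) := by
      rw [hC, ← sum_pred]
      refine Finset.sum_congr rfl fun i _ => ?_
      rw [sub_add_cancel, real_inner_comm]
    nth_rw 2 [e1]
    rw [hC, hN, ← Finset.sum_add_distrib, Finset.mul_sum]
    refine Finset.sum_congr rfl fun i _ => ?_
    rw [← inner_add_right, h.succ_add_pred_of_const hD hE, inner_smul_right]
  have h2 : ∑ i, inner ℝ (v i + v (i + 1)) (v i + v (i + 1)) = (4 - a) * N := by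
    have e2 : ∀ i, inner ℝ (v i + v (i + 1)) (v i + v (i + 1)) =
        inner ℝ (v i) (v i) + 2 * inner ℝ (v i) (v (i + 1)) +
          inner ℝ (v (i + 1)) (v (i + 1)) := by
      intro i
      rw [inner_add_left, inner_add_right, inner_add_right, real_inner_comm (v i) (v (i + 1))]
      ring
    rw [Finset.sum_congr rfl fun i _ => e2 i, Finset.sum_add_distrib, Finset.sum_add_distrib,
      ← Finset.mul_sum, sum_succ fun i => inner ℝ (v i) (v i), ← hN, ← hC]
    linarith
  have h3 : 0 < ∑ i, inner ℝ (v i + v (i + 1)) (v i + v (i + 1)) := by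
    refine Finset.sum_pos (fun i _ => ?_) Finset.univ_nonempty
    rw [real_inner_self_eq_norm_sq]
    refine sq_pos_of_ne_zero (norm_ne_zero_iff.mpr fun h0 => h.edgeArea_ne i ?_)
    rw [edgeArea, eq_neg_of_add_eq_zero_right h0, cross_neg_right, cross_same, neg_zero]
  have h4 : 0 ≤ N := Finset.sum_nonneg fun i _ => real_inner_self_nonneg
  rw [h2] at h3
  by_contra! h5
  nlinarith [mul_nonneg (sub_nonneg.mpr h5) h4]

/-- A convex cycle with constant areas is a linear image of the regular polygon. -/
lemma eq_regCycle_of_const (hm : 3 ≤ m) (h : IsConvexCycle v)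
    (hD : ∀ i, edgeArea v i = edgeArea v 0) (hE : ∀ i, polarArea v i = polarArea v 0) :
    ∃ p q, cross p q ≠ 0 ∧ v = regCycle p q := by
  have ha0 : 0 < edgeArea v 0 * polarArea v 0 := h.edgeArea_mul_polarArea_pos hm 0
  have ha4 := h.lt_four_of_const hD hE
  have hrec := h.succ_add_pred_of_const hD hE
  set a := edgeArea v 0 * polarArea v 0 with ha
  -- This angle satisfies 2 - a = 2 cos θ, the recurrence of points on an ellipse with step θ.
  set θ := Real.arccos (1 - a / 2) with hθ
  have hcos : Real.cos θ = 1 - a / 2 := Real.cos_arccos (by linarith) (by linarith)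
  have hθ0 : 0 < θ := Real.arccos_pos.mpr (by linarith)
  have hθπ : θ < Real.pi := by
    refine lt_of_le_of_ne (Real.arccos_le_pi _) fun e => ?_
    rw [show θ = Real.pi from e, Real.cos_pi] at hcos
    linarith
  have hsin : 0 < Real.sin θ := Real.sin_pos_of_pos_of_lt_pi hθ0 hθπ
  set p := v 0 with hp
  set q := (Real.sin θ)⁻¹ • (v 1 - Real.cos θ • v 0) with hq
  have hv1 : v 1 = ellipse p q θ := by
    rw [ellipse, hq, smul_smul, mul_inv_cancel₀ hsin.ne', one_smul]
    abel
  have hformula : ∀ n : ℕ, v (Fin.ofNat m n) = ellipse p q (n * θ) ∧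
      v (Fin.ofNat m (n + 1)) = ellipse p q ((n + 1) * θ) := by
    intro n
    induction n with
    | zero =>
      constructor
      · simp [ellipse, hp]
      · rw [ofNat_succ, Nat.cast_zero, zero_add, one_mul, ← hv1]
        congr 1
        simp
    | succ n ih =>
      refine ⟨by rw [ih.2]; push_cast; rfl, ?_⟩
      have h1 := hrec (Fin.ofNat m (n + 1))
      rw [← ofNat_succ, ofNat_succ n, add_sub_cancel_right, ← ofNat_succ n, ih.1, ih.2] at h1
      rw [eq_sub_of_add_eq h1, show 2 - a = 2 * Real.cos θ by rw [hcos]; ring]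
      push_cast
      rw [show ((n : ℝ) + 1 + 1) * θ = (n + 1) * θ + θ by ring,
        show (n : ℝ) * θ = (n + 1) * θ - θ by ring]
      simp only [ellipse, Real.cos_add, Real.sin_add, Real.cos_sub, Real.sin_sub]
      module
  have hD0 : edgeArea v 0 = Real.sin θ * cross p q := by
    have := cross_ellipse p q (0 * θ) (1 * θ)
    rw [edgeArea, zero_add, hv1]
    simpa [ellipse] using this
  have hpq : cross p q ≠ 0 := by
    intro h0
    rw [h0, mul_zero] at hD0
    exact h.edgeArea_ne 0 hD0
  have htri : ∀ n : ℕ, triArea (v 0) (v (0 + 1)) (v (Fin.ofNat m n)) = 4 * Real.sin (θ / 2) *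
      Real.sin (n * (θ / 2)) * Real.sin ((n - 1) * (θ / 2)) * cross p q := by
    intro n
    have := triArea_ellipse p q θ 0 n
    rw [zero_add, hv1, (hformula n).1]
    simpa [ellipse] using this
  have hsin2 : 0 < Real.sin (θ / 2) := Real.sin_pos_of_pos_of_lt_pi (by linarith) (by linarith)
  -- Convexity at edge 0 makes consecutive sines have equal sign. Each step adds θ/2 < π/2, so a
  -- half angle that passed π would produce a negative sine.
  have hlt : ∀ n : ℕ, n + 1 < m → (n + 1 : ℝ) * (θ / 2) < Real.pi := by
    intro n
    induction n with
    | zero => intro _; simp only [Nat.cast_zero]; linarith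
    | succ n ih =>
      intro hn
      have h1 := ih (by omega)
      have hval : (Fin.ofNat m (n + 1 + 1)).val = n + 1 + 1 := by
        simp [Nat.mod_eq_of_lt hn]
      have h2 := h.cross_lt 0 (Fin.ofNat m (n + 1 + 1)) (by
        intro e
        rw [e] at hval
        simp at hval) (by
        intro e
        rw [e, zero_add] at hval
        have : (1 : Fin m).val ≤ 1 := by rw [Fin.val_one']; exact Nat.mod_le _ _
        omega)
      rw [← sub_pos, one_sub_cross_polarCycle (h.edgeArea_ne 0), htri, hD0,
        mul_div_mul_right _ _ hpq] at h2
      have h3 := (div_pos_iff_of_pos_right hsin).mp h2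
      push_cast at h3 ⊢
      rw [show (n : ℝ) + 1 + 1 - 1 = n + 1 by ring] at h3
      have h4 : 0 < Real.sin ((n + 1) * (θ / 2)) :=
        Real.sin_pos_of_pos_of_lt_pi (by positivity) h1
      have h5 : 0 < Real.sin (((n : ℝ) + 1 + 1) * (θ / 2)) :=
        (pos_iff_pos_of_mul_pos ((pos_iff_pos_of_mul_pos h3).mpr h4)).mp (by positivity)
      by_contra! h6
      have h7 : Real.sin (((n : ℝ) + 1 + 1) * (θ / 2) - Real.pi) < 0 := by
        rw [Real.sin_sub_pi]; linarith
      have h8 : 0 ≤ Real.sin (((n : ℝ) + 1 + 1) * (θ / 2) - Real.pi) :=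
        Real.sin_nonneg_of_nonneg_of_le_pi (by linarith) (by nlinarith)
      linarith
  -- Closing up after m steps gives sin(mθ/2) = 0, while (m-1)θ/2 < π leaves only mθ/2 = π.
  have hθm : θ = regAngle m := by
    obtain ⟨k, rfl⟩ := Nat.exists_eq_add_of_le' hm
    have h1 := hlt (k + 1) (by omega)
    have h2 := htri (k + 3)
    have h3 : Fin.ofNat (k + 3) (k + 3) = 0 := by apply Fin.ext; simp
    rw [h3] at h2
    have h4 : triArea (v 0) (v (0 + 1)) (v 0) = 0 := by
      rw [triArea, cross_same, cross_comm (v (0 + 1))]; ring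
    rw [h4] at h2
    push_cast at h1 h2
    have h5 : 0 < Real.sin (((k : ℝ) + 3 - 1) * (θ / 2)) :=
      Real.sin_pos_of_pos_of_lt_pi (mul_pos (by have := Nat.cast_nonneg (α := ℝ) k; linarith)
        (by linarith)) (by linarith)
    have h6 : Real.sin (((k : ℝ) + 3) * (θ / 2)) = 0 := by
      by_contra h7
      have : (4 * Real.sin (θ / 2) * Real.sin (((k : ℝ) + 3) * (θ / 2)) *
        Real.sin (((k : ℝ) + 3 - 1) * (θ / 2)) * cross p q) ≠ 0 :=
        mul_ne_zero (mul_ne_zero (mul_ne_zero (by positivity) h7) h5.ne') hpq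
      exact this h2.symm
    have h8 : Real.sin (((k : ℝ) + 3) * (θ / 2) - Real.pi) = 0 := by
      rw [Real.sin_sub_pi, h6, neg_zero]
    have hk : (0 : ℝ) ≤ k := Nat.cast_nonneg k
    have h9 := (Real.sin_eq_zero_iff_of_lt_of_lt (by nlinarith) (by nlinarith)).mp h8
    rw [regAngle]
    push_cast
    rw [eq_div_iff (by linarith)]
    linarith
  refine ⟨p, q, hpq, ?_⟩
  funext i
  rw [regCycle, ← hθm, ← (hformula i.val).1, ofNat_val]

lemma areaFunctional_of_const (hm : 3 ≤ m) (h : IsConvexCycle v)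
    (hD : ∀ i, edgeArea v i = edgeArea v 0) (hE : ∀ i, polarArea v i = polarArea v 0) :
    areaFunctional v = m * Real.log (2 - 2 * Real.cos (regAngle m)) := by
  obtain ⟨p, q, hpq, rfl⟩ := h.eq_regCycle_of_const hm hD hE
  exact areaFunctional_regCycle hm hpq

end IsConvexCycle

end Regular

/-! ### Existence and identification of the maximum for vertex sum zero. -/

section Maximum

variable {m : ℕ} [NeZero m] {v : Fin m → Plane}

section LinearImage

variable {g : Plane →ₗ[ℝ] Plane} {κ : ℝ}

lemma edgeArea_linear (hg : ∀ x y, cross (g x) (g y) = κ * cross x y) (i : Fin m) :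
    edgeArea (g ∘ v) i = κ * edgeArea v i := hg _ _

lemma cornerArea_linear (hg : ∀ x y, cross (g x) (g y) = κ * cross x y) (i : Fin m) :
    cornerArea (g ∘ v) i = κ * cornerArea v i := by
  simp only [cornerArea, triArea, Function.comp_apply, hg]
  ring

lemma cross_polarCycle_linear (hκ : κ ≠ 0) (hg : ∀ x y, cross (g x) (g y) = κ * cross x y)
    (x : Plane) (i : Fin m) :
    cross (g x) (polarCycle (g ∘ v) i) = cross x (polarCycle v i) := by
  rw [polarCycle, edgeArea_linear hg, Function.comp_apply, Function.comp_apply, ← map_sub,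
    cross_smul_right, hg, polarCycle, cross_smul_right, mul_inv]
  field_simp

namespace IsConvexCycle

lemma linear (h : IsConvexCycle v) (hκ : κ ≠ 0)
    (hg : ∀ x y, cross (g x) (g y) = κ * cross x y) : IsConvexCycle (g ∘ v) where
  edgeArea_ne i := by
    rw [edgeArea_linear hg]
    exact mul_ne_zero hκ (h.edgeArea_ne i)
  cross_lt i j h1 h2 := by
    rw [Function.comp_apply, cross_polarCycle_linear hκ hg]
    exact h.cross_lt i j h1 h2

lemma cornerArea_ne (hm : 3 ≤ m) (h : IsConvexCycle v) (i : Fin m) : cornerArea v i ≠ 0 := by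
  rw [cornerArea_eq h.edgeArea_ne]
  exact mul_ne_zero (mul_ne_zero (h.edgeArea_ne _) (h.edgeArea_ne _)) (h.polarArea_ne hm _)

/-- Corner and edge areas both scale by the determinant κ, which cancels between the logarithms. -/
lemma areaFunctional_linear (hm : 3 ≤ m) (h : IsConvexCycle v) (hκ : κ ≠ 0)
    (hg : ∀ x y, cross (g x) (g y) = κ * cross x y) :
    areaFunctional (g ∘ v) = areaFunctional v := by
  refine Finset.sum_congr rfl fun i _ => ?_
  rw [cornerArea_linear hg, edgeArea_linear hg, Real.log_mul hκ (h.cornerArea_ne hm i),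
    Real.log_mul hκ (h.edgeArea_ne i)]
  ring

end IsConvexCycle

end LinearImage

/-- The linear map that sends `a`, `b` to the standard basis. -/
noncomputable def coordMap (a b : Plane) : Plane →ₗ[ℝ] Plane where
  toFun x := !₂[(cross a b)⁻¹ * cross x b, (cross a b)⁻¹ * cross a x]
  map_add' x y := by
    apply plane_ext <;> simp [cross_add_left, cross_add_right] <;> ring
  map_smul' r x := by
    apply plane_ext <;> simp [cross_smul_left, cross_smul_right] <;> ring

lemma cross_coordMap {a b : Plane} (hab : cross a b ≠ 0) (x y : Plane) :
    cross (coordMap a b x) (coordMap a b y) = (cross a b)⁻¹ * cross x y := by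
  have h : cross x b * cross a y - cross a x * cross y b = cross a b * cross x y := by
    simp only [cross]; ring
  have : cross (coordMap a b x) (coordMap a b y) =
      (cross a b)⁻¹ * (cross a b)⁻¹ * (cross x b * cross a y - cross a x * cross y b) := by
    simp [cross, coordMap]; ring
  rw [this, h]
  field_simp

/-- Two of the vertices are the standard basis, and all coordinates are at most one. -/
structure IsNormalized (v : Fin m → Plane) : Prop where
  exists_basis : ∃ a b, v a = !₂[1, 0] ∧ v b = !₂[0, 1]
  abs_le : ∀ i k, |v i k| ≤ 1

namespace IsConvexCycle

lemma exists_isNormalized (hm : 3 ≤ m) (h : IsConvexCycle v) (hs : ∑ i, v i = 0) :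
    ∃ w : Fin m → Plane, IsConvexCycle w ∧ ∑ i, w i = 0 ∧ IsNormalized w ∧
      areaFunctional w = areaFunctional v := by
  -- For a pair of vertices with maximal |det|, the Cramer coordinates of all vertices are quotients
  -- of absolute value at most 1.
  obtain ⟨⟨a, b⟩, hab⟩ := Finite.exists_max fun t : Fin m × Fin m => |cross (v t.1) (v t.2)|
  have hne : cross (v a) (v b) ≠ 0 := by
    have h1 : 0 < |edgeArea v 0| := abs_pos.mpr (h.edgeArea_ne 0)
    exact abs_pos.mp (h1.trans_le (hab (0, 0 + 1)))
  have hg := cross_coordMap hne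
  have hκ := inv_ne_zero hne
  refine ⟨coordMap (v a) (v b) ∘ v, h.linear hκ hg, ?_, ⟨⟨a, b, ?_, ?_⟩, fun i k => ?_⟩,
    h.areaFunctional_linear hm hκ hg⟩
  · simp only [Function.comp_apply]
    rw [← map_sum, hs, map_zero]
  · apply plane_ext <;> simp [coordMap, hne]
  · apply plane_ext <;> simp [coordMap, hne]
  · have hpos := abs_pos.mpr hne
    fin_cases k
    · simp only [coordMap, Function.comp_apply, LinearMap.coe_mk, AddHom.coe_mk, Fin.zero_eta,
        PiLp.toLp_apply, Matrix.cons_val_zero, abs_mul, abs_inv]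
      rw [inv_mul_le_iff₀ hpos, mul_one]
      exact hab (i, b)
    · simp only [coordMap, Function.comp_apply, LinearMap.coe_mk, AddHom.coe_mk, Fin.mk_one,
        PiLp.toLp_apply, Matrix.cons_val_one, Matrix.cons_val_fin_one, abs_mul, abs_inv]
      rw [inv_mul_le_iff₀ hpos, mul_one]
      exact hab (a, i)

/-- Among the vertices that do not lie on an edge, one of the two adjacent ones is nearest. -/
lemma le_one_sub_cross (hm : 3 ≤ m) (h : IsConvexCycle v) {η : ℝ}
    (h1 : ∀ i, η ≤ edgeArea v (i - 1) * polarArea v i)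
    (h2 : ∀ i, η ≤ edgeArea v i * polarArea v i) (i j : Fin m) (hj : j ≠ i) (hj' : j ≠ i + 1) :
    η ≤ 1 - cross (v j) (polarCycle v i) := by
  obtain ⟨k, hk, hmax⟩ := Finset.exists_max_image
    (Finset.univ.filter fun k : Fin m => k ≠ i ∧ k ≠ i + 1)
    (fun k => cross (v k) (polarCycle v i)) ⟨j, by simp [hj, hj']⟩
  simp only [Finset.mem_filter, Finset.mem_univ, true_and] at hk hmax
  refine le_trans ?_ (sub_le_sub_left (hmax j ⟨hj, hj'⟩) 1)
  by_cases hk1 : k = i - 1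
  · rw [hk1, one_sub_cross_pred h.edgeArea_ne]
    exact h1 i
  by_cases hk2 : k = i + 1 + 1
  · rw [hk2, one_sub_cross_succ_succ h.edgeArea_ne]
    exact h2 _
  -- Otherwise vertex k is a local maximum along the cycle, so `polarCycle v i` lies in the cone of
  -- polar vertices k-1 and k with coefficient sum below 1; pairing it with `v i` gives 1 < 1.
  exfalso
  have hs : cross (v (k + 1)) (polarCycle v i) ≤ cross (v k) (polarCycle v i) :=
    hmax _ ⟨fun e => hk1 (eq_sub_of_add_eq e), fun e => hk.1 (add_right_cancel e)⟩
  have hp : cross (v (k - 1)) (polarCycle v i) ≤ cross (v k) (polarCycle v i) :=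
    hmax _ ⟨fun e => hk.2 (eq_add_of_sub_eq e), fun e => hk2 (eq_add_of_sub_eq e)⟩
  obtain ⟨a, b, ha, hb, hab, hx⟩ := (h.polar hm).exists_cone hm (polarCycle v i) (k - 1)
    (by simpa only [h.polarCycle_polarCycle hm, cross_neg_right, ← cross_comm, sub_add_cancel]
        using hs)
    (by simpa only [h.polarCycle_polarCycle hm, cross_neg_right, ← cross_comm, sub_add_cancel]
        using hp)
  rw [h.polarCycle_polarCycle hm, cross_neg_right, ← cross_comm, sub_add_cancel] at hab
  rw [sub_add_cancel] at hx
  have h3 := cross_polarCycle_self h.edgeArea_ne i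
  rw [hx, cross_add_right, cross_smul_right, cross_smul_right] at h3
  have h4 := h.cross_lt i k hk.1 hk.2
  nlinarith [mul_le_mul_of_nonneg_left (h.cross_le (k - 1) i) ha,
    mul_le_mul_of_nonneg_left (h.cross_le k i) hb]

/-- The numbers 1 - det(v_j, f_i) are nonnegative and sum to m over j, so each is at most m; taking
the two basis vertices for v_j bounds both coordinates. -/
lemma abs_polarCycle_le (h : IsConvexCycle v) (hs : ∑ i, v i = 0) (hn : IsNormalized v)
    (i : Fin m) (k : Fin 2) : |polarCycle v i k| ≤ m := by
  have hm1 : (1 : ℝ) ≤ m := by exact_mod_cast NeZero.one_le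
  have h1 : ∀ j, |cross (v j) (polarCycle v i)| ≤ m := by
    intro j
    have hsum : ∑ j, (1 - cross (v j) (polarCycle v i)) = m := by
      rw [Finset.sum_sub_distrib, ← cross_sum_left, hs]
      simp
    have := Finset.single_le_sum (f := fun j => 1 - cross (v j) (polarCycle v i))
      (fun j _ => sub_nonneg.mpr (h.cross_le i j)) (Finset.mem_univ j)
    rw [hsum] at this
    exact abs_le.mpr ⟨by linarith, (h.cross_le i j).trans hm1⟩
  obtain ⟨a, b, ha, hb⟩ := hn.exists_basis
  have h2 := h1 a
  have h3 := h1 b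
  rw [ha] at h2
  rw [hb] at h3
  simp [cross] at h2 h3
  fin_cases k
  · exact h3
  · exact h2

lemma abs_cross_le {x y : Plane} {r : ℝ} (hx : ∀ k, |x k| ≤ r) (hy : ∀ k, |y k| ≤ r) :
    |cross x y| ≤ 2 * r ^ 2 := by
  have hr : 0 ≤ r := (abs_nonneg _).trans (hx 0)
  calc |cross x y| ≤ |x 0 * y 1| + |x 1 * y 0| := abs_sub _ _
    _ = |x 0| * |y 1| + |x 1| * |y 0| := by rw [abs_mul, abs_mul]
    _ ≤ r * r + r * r := add_le_add (mul_le_mul (hx 0) (hy 1) (abs_nonneg _) hr)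
        (mul_le_mul (hx 1) (hy 0) (abs_nonneg _) hr)
    _ = 2 * r ^ 2 := by ring

end IsConvexCycle

lemma exp_le_of_le_sum_log {ι : Type*} [Fintype ι] {x : ι → ℝ} {c C : ℝ} (hC : 1 ≤ C)
    (hx : ∀ i, 0 < x i) (hxC : ∀ i, x i ≤ C) (hc : c ≤ ∑ i, Real.log (x i)) (i : ι) :
    Real.exp (c - Fintype.card ι * Real.log C) ≤ x i := by
  classical
  rw [← Real.le_log_iff_exp_le (hx i)]
  have h1 : ∑ j ∈ Finset.univ.erase i, Real.log (x j) ≤ Fintype.card ι * Real.log C := by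
    calc ∑ j ∈ Finset.univ.erase i, Real.log (x j)
        ≤ ∑ _j ∈ Finset.univ.erase i, Real.log C :=
          Finset.sum_le_sum fun j _ => Real.log_le_log (hx j) (hxC j)
      _ ≤ ∑ _j : ι, Real.log C := Finset.sum_le_sum_of_subset_of_nonneg
          (Finset.erase_subset _ _) fun _ _ _ => Real.log_nonneg hC
      _ = Fintype.card ι * Real.log C := by simp
  rw [← Finset.add_sum_erase _ _ (Finset.mem_univ i)] at hc
  linarith

/-- A compact set of normalized convex cycles. -/
def normalizedCycles (m : ℕ) [NeZero m] (ε η : ℝ) : Set (Fin m → Plane) :=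
  {v | IsNormalized v ∧ ∑ i, v i = 0 ∧ (∀ i, ε ≤ edgeArea v i ^ 2) ∧
    -- The inequality η ≤ 1 - det(v_j, f_i) times D_i²: without a division it is a closed condition.
    ∀ i j, j ≠ i → j ≠ i + 1 → η * edgeArea v i ^ 2 ≤
      edgeArea v i ^ 2 - edgeArea v i * cross (v j) (v (i + 1) - v i)}

lemma isConvexCycle_of_mem_normalizedCycles {ε η : ℝ} (hε : 0 < ε) (hη : 0 < η)
    (hv : v ∈ normalizedCycles m ε η) : IsConvexCycle v := by
  obtain ⟨-, -, h1, h2⟩ := hv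
  have hD : ∀ i, edgeArea v i ≠ 0 := fun i => sq_pos_iff.mp (hε.trans_le (h1 i))
  refine ⟨hD, fun i j h3 h4 => ?_⟩
  have h5 := h2 i j h3 h4
  have h6 : 0 < edgeArea v i ^ 2 := hε.trans_le (h1 i)
  have h7 : edgeArea v i * cross (v j) (v (i + 1) - v i) =
      edgeArea v i ^ 2 * cross (v j) (polarCycle v i) := by
    rw [polarCycle, cross_smul_right]
    have := hD i
    field_simp
  rw [h7] at h5
  nlinarith [mul_pos hη h6]

lemma isCompact_normalizedCycles (ε η : ℝ) : IsCompact (normalizedCycles m ε η) := by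
  apply Metric.isCompact_of_isClosed_isBounded
  · have hD : ∀ i : Fin m, Continuous fun w : Fin m → Plane => edgeArea w i := by
      intro i
      unfold edgeArea cross
      fun_prop
    have h1 : IsClosed {v : Fin m → Plane | IsNormalized v} := by
      have : {v : Fin m → Plane | IsNormalized v} =
          (⋃ a, ⋃ b, {v | v a = !₂[1, 0]} ∩ {v | v b = !₂[0, 1]}) ∩
            ⋂ i, ⋂ k, {v | |v i k| ≤ 1} := by
        ext v
        simp only [Set.mem_ofPred_eq, Set.mem_inter_iff, Set.mem_iUnion, Set.mem_iInter]
        exact ⟨fun h => ⟨h.1, h.2⟩, fun h => ⟨h.1, h.2⟩⟩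
      rw [this]
      refine IsClosed.inter (isClosed_iUnion_of_finite fun a => isClosed_iUnion_of_finite fun b =>
        IsClosed.inter (isClosed_eq (by fun_prop) continuous_const)
          (isClosed_eq (by fun_prop) continuous_const))
        (isClosed_iInter fun i => isClosed_iInter fun k => isClosed_le (by fun_prop)
          continuous_const)
    have h2 : IsClosed {v : Fin m → Plane | ∑ i, v i = 0} :=
      isClosed_eq (by fun_prop) continuous_const
    have h3 : IsClosed {v : Fin m → Plane | ∀ i, ε ≤ edgeArea v i ^ 2} := by
      rw [Set.ofPred_forall]
      exact isClosed_iInter fun i => isClosed_le continuous_const ((hD i).pow 2)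
    have h4 : IsClosed {v : Fin m → Plane | ∀ i j, j ≠ i → j ≠ i + 1 → η * edgeArea v i ^ 2 ≤
        edgeArea v i ^ 2 - edgeArea v i * cross (v j) (v (i + 1) - v i)} := by
      simp only [Set.ofPred_forall]
      refine isClosed_iInter fun i => isClosed_iInter fun j => isClosed_iInter fun _ =>
        isClosed_iInter fun _ => isClosed_le (continuous_const.mul ((hD i).pow 2))
          (((hD i).pow 2).sub ((hD i).mul ?_))
      unfold cross
      fun_prop
    exact h1.inter (h2.inter (h3.inter h4))
  · rw [Metric.isBounded_iff_subset_closedBall (0 : Fin m → Plane)]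
    refine ⟨2, fun v hv => ?_⟩
    rw [mem_closedBall_zero_iff, pi_norm_le_iff_of_nonneg zero_le_two]
    intro i
    have h0 := sq_le_one_iff_abs_le_one (v i 0) |>.mpr (hv.1.abs_le i 0)
    have h1 := sq_le_one_iff_abs_le_one (v i 1) |>.mpr (hv.1.abs_le i 1)
    rw [EuclideanSpace.norm_eq, Real.sqrt_le_left zero_le_two, Fin.sum_univ_two, Real.norm_eq_abs,
      Real.norm_eq_abs, sq_abs, sq_abs]
    linarith

namespace IsConvexCycle

lemma continuousAt_areaFunctional (hm : 3 ≤ m) (h : IsConvexCycle v) :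
    ContinuousAt areaFunctional v := by
  unfold areaFunctional
  refine tendsto_finsetSum _ fun i _ => ?_
  refine ContinuousAt.sub (ContinuousAt.log ?_ (h.cornerArea_ne hm i))
    (ContinuousAt.log ?_ (h.edgeArea_ne i))
  · unfold cornerArea triArea cross
    fun_prop
  · unfold edgeArea cross
    fun_prop

/-- Normalized cycles on which the area functional is bounded from below lie in a compact set. -/
lemma mem_normalizedCycles (hm : 3 ≤ m) (h : IsConvexCycle v) (hs : ∑ i, v i = 0)
    (hn : IsNormalized v) {c : ℝ} (hc : c ≤ areaFunctional v) :
    v ∈ normalizedCycles m (Real.exp (c - m * Real.log (4 * m ^ 2)) ^ 2 / (2 * m ^ 2) ^ 2)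
      (Real.exp (c - m * Real.log (4 * m ^ 2))) := by
  set η := Real.exp (c - m * Real.log (4 * m ^ 2)) with hη
  have hm1 : (1 : ℝ) ≤ m := by exact_mod_cast NeZero.one_le
  have hC : (1 : ℝ) ≤ 4 * m ^ 2 := by nlinarith
  have hDle : ∀ i, |edgeArea v i| ≤ 2 := fun i => by
    simpa [edgeArea] using abs_cross_le (hn.abs_le i) (hn.abs_le (i + 1))
  have hEle : ∀ i, |polarArea v i| ≤ 2 * m ^ 2 := fun i =>
    abs_cross_le (h.abs_polarCycle_le hs hn _) (h.abs_polarCycle_le hs hn _)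
  -- 4m² bounds every product of an edge and a polar area; since Σ log(D_{i-1} E_i) and Σ log(D_i
  -- E_i) both equal c₁, no such factor can fall below η.
  have hDE : ∀ i j, edgeArea v i * polarArea v j ≤ 4 * m ^ 2 := fun i j => by
    refine (le_abs_self _).trans ?_
    rw [abs_mul]
    refine (mul_le_mul (hDle i) (hEle j) (abs_nonneg _) zero_le_two).trans_eq (by ring)
  have hlog : ∀ i j, Real.log (edgeArea v i * polarArea v j) =
      Real.log (edgeArea v i) + Real.log (polarArea v j) := fun i j =>
    Real.log_mul (h.edgeArea_ne i) (h.polarArea_ne hm j)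
  have h1 : ∀ i, η ≤ edgeArea v (i - 1) * polarArea v i := by
    have := exp_le_of_le_sum_log (c := c) hC (h.edgeArea_pred_mul_pos hm) (fun i => hDE _ _) (by
      simp only [hlog, Finset.sum_add_distrib]
      rwa [sum_pred fun i => Real.log (edgeArea v i), ← h.areaFunctional_eq hm])
    simpa using this
  have h2 : ∀ i, η ≤ edgeArea v i * polarArea v i := by
    have := exp_le_of_le_sum_log (c := c) hC (h.edgeArea_mul_polarArea_pos hm) (fun i => hDE _ _)
      (by
        simp only [hlog, Finset.sum_add_distrib]
        rwa [← h.areaFunctional_eq hm])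
    simpa using this
  refine ⟨hn, hs, fun i => ?_, fun i j h3 h4 => ?_⟩
  · rw [div_le_iff₀ (by positivity)]
    calc η ^ 2 ≤ (edgeArea v i * polarArea v i) ^ 2 :=
          pow_le_pow_left₀ (Real.exp_pos _).le (h2 i) 2
      _ = edgeArea v i ^ 2 * polarArea v i ^ 2 := by ring
      _ ≤ edgeArea v i ^ 2 * (2 * m ^ 2) ^ 2 := by
          refine mul_le_mul_of_nonneg_left ?_ (sq_nonneg _)
          rw [← sq_abs]
          exact pow_le_pow_left₀ (abs_nonneg _) (hEle i) 2
  · have h5 := h.le_one_sub_cross hm h1 h2 i j h3 h4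
    have h6 := mul_le_mul_of_nonneg_right h5 (sq_nonneg (edgeArea v i))
    refine h6.trans_eq ?_
    rw [polarCycle, cross_smul_right]
    have := h.edgeArea_ne i
    field_simp

lemma exists_forall_areaFunctional_le (hm : 3 ≤ m) (h : IsConvexCycle v) (hs : ∑ i, v i = 0) :
    ∃ w : Fin m → Plane, IsConvexCycle w ∧ ∑ i, w i = 0 ∧
      ∀ u : Fin m → Plane, IsConvexCycle u → ∑ i, u i = 0 →
        areaFunctional u ≤ areaFunctional w := by
  obtain ⟨v₀, hv₀, hs₀, hn₀, -⟩ := h.exists_isNormalized hm hs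
  set c := areaFunctional v₀ with hc
  set η := Real.exp (c - m * Real.log (4 * m ^ 2)) with hη
  have hηpos : 0 < η := Real.exp_pos _
  have hm0 : (0 : ℝ) < m := by exact_mod_cast NeZero.pos m
  have hε : 0 < η ^ 2 / (2 * (m : ℝ) ^ 2) ^ 2 := by positivity
  have hmem₀ := hv₀.mem_normalizedCycles hm hs₀ hn₀ hc.le
  obtain ⟨w, hw, hmax⟩ := (isCompact_normalizedCycles _ _).exists_isMaxOn ⟨v₀, hmem₀⟩
    (fun u hu => ((isConvexCycle_of_mem_normalizedCycles hε hηpos hu).continuousAt_areaFunctional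
      hm).continuousWithinAt)
  refine ⟨w, isConvexCycle_of_mem_normalizedCycles hε hηpos hw, hw.2.1, fun u hu hus => ?_⟩
  obtain ⟨u', hu', hus', hun', he⟩ := hu.exists_isNormalized hm hus
  rw [← he]
  -- Cycles with value below that of the reference cycle v₀ may lie outside the compact set, but
  -- cannot beat its maximum.
  rcases le_total c (areaFunctional u') with h1 | h1
  · exact hmax (hu'.mem_normalizedCycles hm hus' hun' h1)
  · exact h1.trans (hmax hmem₀)

lemma areaFunctional_le (hm : 3 ≤ m) (h : IsConvexCycle v) (hs : ∑ i, v i = 0) :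
    areaFunctional v ≤ m * Real.log (2 - 2 * Real.cos (regAngle m)) := by
  obtain ⟨w, hw, hws, hmax⟩ := h.exists_forall_areaFunctional_le hm hs
  obtain ⟨hD, hE⟩ := hw.areas_const_of_forall_le hm hws hmax
  rw [← hw.areaFunctional_of_const hm hD hE]
  exact hmax v h hs

lemma areas_const_of_areaFunctional_ge (hm : 3 ≤ m) (h : IsConvexCycle v) (hs : ∑ i, v i = 0)
    (hge : m * Real.log (2 - 2 * Real.cos (regAngle m)) ≤ areaFunctional v) :
    (∀ i, edgeArea v i = edgeArea v 0) ∧ ∀ i, polarArea v i = polarArea v 0 :=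
  h.areas_const_of_forall_le hm hs fun _ hw hws => (hw.areaFunctional_le hm hws).trans hge

end IsConvexCycle

end Maximum

/-! ### Change of centre and the Santaló point at infinity. -/

section Translation

variable {m : ℕ} [NeZero m] {v : Fin m → Plane} {x : Plane}

lemma edgeArea_translate {i : Fin m} (hD : edgeArea v i ≠ 0) (x : Plane) :
    edgeArea (fun j => v j - x) i = edgeArea v i * (1 - cross x (polarCycle v i)) := by
  rw [polarCycle, cross_smul_right, mul_sub, mul_one, ← mul_assoc, mul_inv_cancel₀ hD, one_mul,
    edgeArea, edgeArea]
  simp [cross]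
  ring

lemma cornerArea_translate (i : Fin m) (x : Plane) :
    cornerArea (fun j => v j - x) i = cornerArea v i := by
  simp [cornerArea, triArea, cross]
  ring

namespace IsConvexCycle

lemma translate (h : IsConvexCycle v) (hx : ∀ k, cross x (polarCycle v k) < 1) :
    IsConvexCycle fun j => v j - x where
  edgeArea_ne i := by
    rw [edgeArea_translate (h.edgeArea_ne i)]
    exact mul_ne_zero (h.edgeArea_ne i) (sub_pos.mpr (hx i)).ne'
  cross_lt i j h1 h2 := by
    rw [polarCycle, edgeArea_translate (h.edgeArea_ne i), sub_sub_sub_cancel_right, mul_inv_rev,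
      mul_smul, ← polarCycle, cross_smul_right, inv_mul_lt_iff₀ (sub_pos.mpr (hx i)),
      cross_sub_left, mul_one]
    exact sub_lt_sub_right (h.cross_lt i j h1 h2) _

/-- Corner areas are translation invariant, so only the edge areas contribute. -/
lemma areaFunctional_translate (h : IsConvexCycle v) (hx : ∀ k, cross x (polarCycle v k) < 1) :
    areaFunctional (fun j => v j - x) =
      areaFunctional v - ∑ i, Real.log (1 - cross x (polarCycle v i)) := by
  rw [areaFunctional, areaFunctional, ← Finset.sum_sub_distrib]
  refine Finset.sum_congr rfl fun i _ => ?_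
  rw [cornerArea_translate, edgeArea_translate (h.edgeArea_ne i),
    Real.log_mul (h.edgeArea_ne i) (sub_pos.mpr (hx i)).ne']
  ring

lemma secondTermAt_convexHull (hm : 3 ≤ m) (h : IsConvexCycle v)
    (hx : ∀ k, cross x (polarCycle v k) < 1) :
    secondTermAt (convexHull ℝ (Set.range v)) x =
      areaFunctional v - ∑ i, Real.log (1 - cross x (polarCycle v i)) := by
  have himage : (fun p => p - x) '' convexHull ℝ (Set.range v) =
      convexHull ℝ (Set.range fun j => v j - x) := by
    have := (AffineEquiv.constVAdd ℝ Plane (-x)).toAffineMap.image_convexHull (Set.range v)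
    rw [← Set.range_comp] at this
    simpa [Function.comp_def, neg_add_eq_sub] using this
  rw [secondTermAt, himage, (h.translate hx).secondTerm_convexHull hm,
    h.areaFunctional_translate hx]

/-- The Santaló point at infinity is the origin if and only if the vertices of the polar polygon
sum up to zero. -/
lemma isSantaloPointAtInfinity_zero_iff (hm : 3 ≤ m) (h : IsConvexCycle v) :
    IsSantaloPointAtInfinity (convexHull ℝ (Set.range v)) 0 ↔ ∑ i, polarCycle v i = 0 := by
  have h0 : ∀ k, cross 0 (polarCycle v k) < 1 := fun k => by simp
  rw [IsSantaloPointAtInfinity, h.interior_convexHull hm, h.secondTermAt_convexHull hm h0]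
  simp only [cross_zero_left, sub_zero, Real.log_one, Finset.sum_const_zero]
  constructor
  · rintro ⟨-, hmin⟩
    -- In this direction the derivative at 0 is minus the squared length of Σ f_i.
    set y := quarterTurn (∑ i, polarCycle v i) with hy
    have hd : HasDerivAt (fun t : ℝ => ∑ i, Real.log (1 - t * cross y (polarCycle v i)))
        (∑ i, -cross y (polarCycle v i)) 0 := by
      refine HasDerivAt.fun_sum fun i _ => ?_
      have h1 : HasDerivAt (fun t : ℝ => 1 - t * cross y (polarCycle v i))
          (-cross y (polarCycle v i)) 0 := by
        simpa using ((hasDerivAt_id (0 : ℝ)).mul_const (cross y (polarCycle v i))).const_sub 1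
      simpa using h1.log (by simp)
    have hmax : IsLocalMax (fun t : ℝ => ∑ i, Real.log (1 - t * cross y (polarCycle v i))) 0 := by
      have hev : ∀ᶠ t in nhds (0 : ℝ), ∀ k, t * cross y (polarCycle v k) < 1 := by
        refine Filter.eventually_all.mpr fun k => ?_
        have hc : ContinuousAt (fun t : ℝ => t * cross y (polarCycle v k)) 0 := by fun_prop
        exact hc.eventually (gt_mem_nhds (by simp))
      filter_upwards [hev] with t ht
      simp only [zero_mul, sub_zero, Real.log_one, Finset.sum_const_zero]
      have ht' : ∀ k, cross (t • y) (polarCycle v k) < 1 := fun k => by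
        rw [cross_smul_left]
        exact ht k
      by_cases hty : t • y = 0
      · refine (Finset.sum_eq_zero fun i _ => ?_).le
        rw [← cross_smul_left, hty]
        simp
      · have h2 := hmin (t • y) ht' hty
        rw [h.secondTermAt_convexHull hm ht'] at h2
        simp only [cross_smul_left] at h2
        linarith
    have h3 := hmax.hasDerivAt_eq_zero hd
    rw [Finset.sum_neg_distrib, neg_eq_zero, ← cross_sum_right] at h3
    exact eq_zero_of_cross_quarterTurn h3
  · intro hs
    refine ⟨h0, fun x hx hx0 => ?_⟩
    rw [h.secondTermAt_convexHull hm hx]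
    have hsum : ∑ i, -cross x (polarCycle v i) = 0 := by
      rw [Finset.sum_neg_distrib, ← cross_sum_right, hs, cross_zero_right, neg_zero]
    have hex : ∃ i, cross x (polarCycle v i) ≠ 0 := by
      by_contra! hall
      refine hx0 (eq_of_cross_eq (h.polarArea_ne hm 0) ?_ ?_) <;> rw [hall, cross_zero_left]
    obtain ⟨i, hi⟩ := hex
    -- log u ≤ u - 1, strict for u ≠ 1, gives the strict global minimum directly.
    have hlt : ∑ i, Real.log (1 - cross x (polarCycle v i)) < ∑ i, -cross x (polarCycle v i) := by
      refine Finset.sum_lt_sum (fun j _ => ?_) ⟨i, Finset.mem_univ i, ?_⟩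
      · have := Real.log_le_sub_one_of_pos (sub_pos.mpr (hx j))
        linarith
      · have := Real.log_lt_sub_one_of_pos (sub_pos.mpr (hx i)) (by
          intro e
          exact hi (by linarith))
        linarith
    linarith

end IsConvexCycle

end Translation

end CyclicPolygon

/-! ### Assembly: part 1 on the polygon itself, part 2 through its polar. -/

open CyclicPolygon

theorem theorem1p6 (m : ℕ) (hm : 3 ≤ m) :
    (∀ P ∈ polygons m, IsStationaryAt m P → IsLinearImageOfRegular m P) ∧
    (∀ P : Set Plane,
      (P ∈ polygons m ∧ IsSantaloPointAtInfinity P 0 ∧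
        ∀ Q ∈ polygons m, IsSantaloPointAtInfinity Q 0 → secondTerm Q ≤ secondTerm P) ↔
      IsLinearImageOfRegular m P) := by
  have : NeZero m := ⟨by omega⟩
  have hreg : ∀ p q : Plane, cross p q ≠ 0 →
      convexHull ℝ (Set.range (regCycle (m := m) p q)) ∈ polygons m ∧
      IsSantaloPointAtInfinity (convexHull ℝ (Set.range (regCycle (m := m) p q))) 0 ∧
      secondTerm (convexHull ℝ (Set.range (regCycle (m := m) p q))) =
        m * Real.log (2 - 2 * Real.cos (regAngle m)) := by
    intro p q hpq
    have h := isConvexCycle_regCycle hm hpq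
    exact ⟨⟨_, (isVertexCycle_iff hm).mpr h, rfl⟩,
      (h.isSantaloPointAtInfinity_zero_iff hm).mpr (sum_polarCycle_regCycle p q),
      (h.secondTerm_convexHull hm).trans (areaFunctional_regCycle hm hpq)⟩
  constructor
  · rintro P - ⟨v, hv, rfl, hd⟩
    have h := (isVertexCycle_iff hm).mp hv
    obtain ⟨hD, hE⟩ := h.areas_const_of_hasFDerivAt hm hd
    obtain ⟨p, q, hpq, rfl⟩ := h.eq_regCycle_of_const hm hD hE
    exact isLinearImageOfRegular_iff.mpr ⟨p, q, hpq, rfl⟩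
  · intro P
    rw [isLinearImageOfRegular_iff]
    constructor
    · rintro ⟨⟨v, hv, rfl⟩, hs, hmax⟩
      have h := (isVertexCycle_iff hm).mp hv
      rw [h.isSantaloPointAtInfinity_zero_iff hm] at hs
      obtain ⟨h1, h2, h3⟩ := hreg !₂[1, 0] !₂[0, 1] (by simp [cross])
      have hge := hmax _ h1 h2
      rw [h3, h.secondTerm_convexHull hm, ← h.areaFunctional_polarCycle hm] at hge
      obtain ⟨hD, hE⟩ := (h.polar hm).areas_const_of_areaFunctional_ge hm hs hge
      -- Polarity exchanges the two families of areas, with a shift by one, so constancy for the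
      -- polar gives constancy for `v`.
      simp only [IsConvexCycle.edgeArea_polarCycle, h.polarArea_polarCycle hm] at hD hE
      have hE' : ∀ i, polarArea v i = polarArea v (0 + 1) := fun i => by
        simpa using hD (i - 1)
      obtain ⟨p, q, hpq, rfl⟩ := h.eq_regCycle_of_const hm hE fun i =>
        (hE' i).trans (hE' 0).symm
      exact ⟨p, q, hpq, rfl⟩
    · rintro ⟨p, q, hpq, rfl⟩
      obtain ⟨h1, h2, h3⟩ := hreg p q hpq
      refine ⟨h1, h2, ?_⟩
      rintro _ ⟨w, hw, rfl⟩ hs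
      have h := (isVertexCycle_iff hm).mp hw
      rw [h.isSantaloPointAtInfinity_zero_iff hm] at hs
      rw [h3, h.secondTerm_convexHull hm, ← h.areaFunctional_polarCycle hm]
      exact (h.polar hm).areaFunctional_le hm hs
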